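/- **Setting.** A star metric $S$ with finite leaf set $V$, $|V|\ge 2$, is given by edge weights $w_x\ge 0$ $(x\in V)$; the travelling time between distinct leaves $x,y$ is $w_x+w_y$ (and $0$ if $x=y$), and $w(S)=\sum_{x\in V}w_x$. Travelling between two distinct leaves is assumed to take at least one time unit, i.e. $w_x+w_y\ge 1$ for all $x\ne y$. An input $\sigma$ is a finite sequence of requests $([r_i,d_i],v_i)$ with $r_i,d_i$ positive integers and $v_i\in V$, ordered by release time; its minimum laxity is $\min_i (d_i-r_i)$. A schedule serves some of the requests: request $i$, if served, occupies a time interval $[s_i,s_i+1]\subseteq[r_i,d_i]$ ($s_i$ real), and between the services of any two requests there is at least the travelling time between their nodes. $\mathrm{OPT}(\sigma)$ is the largest number of requests served by a schedule for $\sigma$. A deterministic online algorithm assigns a schedule to every input so that the services started up to any time $t$ depend only on the requests released up to time $t$; a randomized online algorithm is a random choice of a deterministic one; $\mathrm{ALG}(\sigma)$ is the number of requests that it serves. For an integer $L\ge 1$, the algorithm is $\rho$-competitive for laxity $L$ if $\mathrm{OPT}(\sigma)\le\rho\cdot\mathbb E[\mathrm{ALG}(\sigma)]$ for every input $\sigma$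 of minimum laxity $L$. **Theorem.** There is an absolute constant $c>0$ such that for every star metric $S$ as above and every integer $L\ge 1$, with $\delta=w(S)/L$, the following holds for every deterministic or randomized online algorithm for $S$ that is $\rho$-competitive for laxity $L$: * if $\delta\le\frac19$, then $\rho\ge 1+c\sqrt\delta$; * if $\delta>\frac19$, then $\rho\ge 1.002$. -/

import Mathlib

open MeasureTheory

namespace StarTSP

universe u v

/-- A star metric with finite set of leaves `V`, given by the weights of the edges joining the
leaves to the centre. Distinct leaves are at positive distance. -/
structure StarMetric (V : Type u) where
  weight : V → ℝ
  weight_nonneg : ∀ x, 0 ≤ weight x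
  separated : ∀ x y, x ≠ y → 0 < weight x + weight y

namespace StarMetric

variable {V : Type u}

open Classical in
/-- The distance (= travelling time) between two leaves: through the centre. -/
noncomputable def dist (S : StarMetric V) (x y : V) : ℝ :=
  if x = y then 0 else S.weight x + S.weight y

/-- `w(S)`, the sum of the weights of all edges of the star. -/
noncomputable def totalWeight [Fintype V] (S : StarMetric V) : ℝ :=
  ∑ x, S.weight x

end StarMetric

/-- A request `([release, deadline], node)`, with release time and deadline positive integers. -/
structure Request (V : Type u) where
  release : ℕ
  deadline : ℕ
  node : V
  release_pos : 0 < release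
  deadline_pos : 0 < deadline

/-- An input: a finite sequence of requests, listed in the order of arrival. A request is
referred to by its position in the list, so that identical requests remain distinct. -/
structure Input (V : Type u) where
  requests : List (Request V)
  sorted : requests.Pairwise (fun p q => p.release ≤ q.release)

/-- The requests that have arrived up to and including time `t` (a prefix of the input). -/
def Input.revealed {V : Type u} (σ : Input V) (t : ℕ) : List (Request V) :=
  σ.requests.filter (fun q => decide (q.release ≤ t))

/-- The minimum laxity `min (deadline - release)` of the requests of `σ` equals `L`. -/
def Input.HasMinLaxity {V : Type u} (σ : Input V) (L : ℕ) : Prop :=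
  (∀ q ∈ σ.requests, q.release + L ≤ q.deadline) ∧
    ∃ q ∈ σ.requests, q.release + L = q.deadline

/-- A schedule: `x i = some s` means that the service of the `i`-th request starts at the (real)
time `s`; `x i = none` means that the request is not served. -/
abbrev Schedule : Type := ℕ → Option ℝ

/-- Feasibility of a schedule for the input `σ`: only requests of `σ` are served; the unit of
service takes place within the time window; between any two services there is enough time to
travel from the node of the earlier one to the node of the later one. -/
structure IsFeasible {V : Type u} (S : StarMetric V) (σ : Input V) (x : Schedule) : Prop where
  window : ∀ (i : ℕ) (s : ℝ), x i = some s →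
    ∃ q, σ.requests[i]? = some q ∧ (q.release : ℝ) ≤ s ∧ s + 1 ≤ (q.deadline : ℝ)
  travel : ∀ (i j : ℕ) (p q : Request V) (s t : ℝ), i ≠ j →
    σ.requests[i]? = some p → σ.requests[j]? = some q → x i = some s → x j = some t →
    s + 1 + S.dist p.node q.node ≤ t ∨ t + 1 + S.dist q.node p.node ≤ s

/-- The throughput of a schedule: the number of requests of `σ` that are served. -/
def throughput {V : Type u} (σ : Input V) (x : Schedule) : ℕ :=
  ((Finset.range σ.requests.length).filter (fun i => (x i).isSome)).card

/-- `OPT(σ)`: the largest throughput of a feasible schedule (at most the number of requests,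
so that the supremum is a maximum). -/
noncomputable def opt {V : Type u} (S : StarMetric V) (σ : Input V) : ℕ :=
  sSup {k : ℕ | ∃ x : Schedule, IsFeasible S σ x ∧ throughput σ x = k}

/-- A deterministic online algorithm. It produces a feasible schedule for every input, and
whatever it starts before time `t + 1` depends only on the requests that arrived up to time `t`
(requests arrive at integer times only). Besides feasibility, nothing is required about when the
decision to travel is taken; this only makes the class of algorithms larger. -/
structure OnlineAlgorithm {V : Type u} (S : StarMetric V) where
  run : Input V → Schedule
  feasible : ∀ σ, IsFeasible S σ (run σ)
  nonanticipative : ∀ (σ τ : Input V) (t : ℕ), σ.revealed t = τ.revealed t →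
    ∀ (i : ℕ) (s : ℝ), s < (t : ℝ) + 1 → (run σ i = some s ↔ run τ i = some s)

/-- A randomized online algorithm: a deterministic online algorithm for each outcome `ω` of the
random choices, such that the time at which a given request of a given input starts to be served
is a random variable (possibly undefined, if the request is not served). -/
structure RandomizedOnlineAlgorithm {V : Type u} (S : StarMetric V)
    (Ω : Type v) [MeasurableSpace Ω] where
  alg : Ω → OnlineAlgorithm S
  measurable_start : ∀ (σ : Input V) (i : ℕ) (t : ℝ),
    MeasurableSet {ω | ∃ s : ℝ, s ≤ t ∧ (alg ω).run σ i = some s}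

/-- `E[ALG(σ)]`, when the random choices are distributed according to `P`. -/
noncomputable def RandomizedOnlineAlgorithm.expectedThroughput {V : Type u} {S : StarMetric V}
    {Ω : Type v} [MeasurableSpace Ω] (A : RandomizedOnlineAlgorithm S Ω) (P : Measure Ω)
    (σ : Input V) : ℝ :=
  ∫ ω, (throughput σ ((A.alg ω).run σ) : ℝ) ∂P

/-- The deterministic algorithm `A` has competitive ratio at most `ρ` on the inputs with minimum
laxity `L`. -/
def OnlineAlgorithm.IsCompetitive {V : Type u} {S : StarMetric V} (A : OnlineAlgorithm S)
    (L : ℕ) (ρ : ℝ) : Prop :=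
  ∀ σ : Input V, σ.HasMinLaxity L → (opt S σ : ℝ) ≤ ρ * (throughput σ (A.run σ) : ℝ)

/-- The randomized algorithm `A` has competitive ratio at most `ρ` (in expectation, against a
sequence fixed in advance) on the inputs with minimum laxity `L`. -/
def RandomizedOnlineAlgorithm.IsCompetitive {V : Type u} {S : StarMetric V}
    {Ω : Type v} [MeasurableSpace Ω] (A : RandomizedOnlineAlgorithm S Ω) (P : Measure Ω)
    (L : ℕ) (ρ : ℝ) : Prop :=
  ∀ σ : Input V, σ.HasMinLaxity L → (opt S σ : ℝ) ≤ ρ * A.expectedThroughput P σ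

end StarTSP

/-! Two inputs agree until late. At time `1` both release early requests at a home leaf that fill an
initial phase of length `H ≥ L`; `m` blocks of `2M` requests, each block due by the end of its own
slot of length `2M`, with `M` requests at home and `M` spread over the other leaves roughly in
proportion to their weights; and `m * M` fillers at home, due at the very end. The flooded input
adds, after the last slot, enough home requests to fill the final phase.

With the flood, it is best never to leave home: block requests at home and fillers together fill the
slots, and no time is spent on travelling (`le_opt_floodedInput`). Without it, one can tour the star
once per slot, giving up about `2 * w(S)` home requests per block, and serve all fillers afterwards
(`le_opt_input`).

An online algorithm acts identically on both inputs until the flood. With the flood, every unit of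
travelling costs one service (`Separated.card_add_sum_visitWeight_le`). Without it, the requests of
a block at leaves skipped in its slot are lost or were served early, and early services displace as
many other requests (`sum_mult_le`). The same loss can excuse skipped leaves in all `m` blocks, so
the multiplicities carry a factor `m + 1`. Hence `ALG(σ) + ALG(τ) / 12` stays below `OPT(σ) + OPT(τ)
/ 12` by `m * w / 2`, where `w ≥ w(S) / 2` (`exists_hard_inputs`).

This inequality is linear, so it survives expectation. Its left side is `O(H + m ^ 2 * w)`, which
bounds `ρ - 1` from below by the quotient. Taking `H = L` and `m` about `1 / √δ` gives order `√δ`;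
for large `δ`, one block and `H` about `9 * w(S)` give a constant (`ratio_bounds`). -/

namespace StarTSP

/-! ### Inputs and schedules indexed by labels instead of list positions -/

/-- A schedule for a family of requests indexed by an arbitrary type: no request is started outside
its window, and any two services leave enough time for travelling. -/
structure IsFeasibleFamily {V ι : Type*} (S : StarMetric V) (req : ι → Request V)
    (x : ι → Option ℝ) : Prop where
  window : ∀ a s, x a = some s → ((req a).release : ℝ) ≤ s ∧ s + 1 ≤ ((req a).deadline : ℝ)
  travel : ∀ a b s t, a ≠ b → x a = some s → x b = some t →
    s + 1 + S.dist (req a).node (req b).node ≤ t ∨ t + 1 + S.dist (req b).node (req a).node ≤ s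

/-- `idx` lists the positions in the input `σ` of a family of requests that exhausts `σ`. -/
structure Labelling {V ι : Type*} (σ : Input V) (req : ι → Request V) (idx : ι → ℕ) : Prop where
  injective : Function.Injective idx
  getElem? : ∀ a, σ.requests[idx a]? = some (req a)
  surjective : ∀ i < σ.requests.length, ∃ a, idx a = i

namespace Labelling

variable {V ι : Type*} {σ : Input V} {req : ι → Request V} {idx : ι → ℕ}

theorem idx_lt (h : Labelling σ req idx) (a : ι) : idx a < σ.requests.length := by
  have := h.getElem? a
  exact (List.getElem?_eq_some_iff.1 this).1

theorem throughput_eq [Fintype ι] (h : Labelling σ req idx) (x : Schedule) :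
    throughput σ x = (Finset.univ.filter (fun a => (x (idx a)).isSome)).card := by
  unfold throughput
  symm
  refine Finset.card_bij (fun a _ => idx a) ?_ (fun a _ b _ hab => h.injective hab) ?_
  · intro a ha
    have := h.idx_lt a
    simp_all
  · intro i hi
    simp only [Finset.mem_filter, Finset.mem_range] at hi
    obtain ⟨a, rfl⟩ := h.surjective i hi.1
    exact ⟨a, by simpa using hi.2, rfl⟩

theorem isFeasibleFamily (h : Labelling σ req idx) {S : StarMetric V} {x : Schedule}
    (hx : IsFeasible S σ x) : IsFeasibleFamily S req (fun a => x (idx a)) where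
  window a s hs := by
    obtain ⟨q, hq, h1⟩ := hx.window _ _ hs
    rw [h.getElem? a] at hq
    cases hq
    exact h1
  travel a b s t hab hs ht :=
    hx.travel _ _ _ _ _ _ (fun e => hab (h.injective e)) (h.getElem? a) (h.getElem? b) hs ht

theorem card_le_opt [Fintype ι] (h : Labelling σ req idx) {S : StarMetric V} {x : ι → Option ℝ}
    (hx : IsFeasibleFamily S req x) :
    (Finset.univ.filter (fun a => (x a).isSome)).card ≤ opt S σ := by
  classical
  let y : Schedule := Function.extend idx x (fun _ => none)
  have hy : ∀ a, y (idx a) = x a := fun a => h.injective.extend_apply _ _ _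
  have hy' : ∀ i s, y i = some s → ∃ a, idx a = i := by
    intro i s his
    by_contra hne
    have : y i = none := Function.extend_apply' _ _ _ hne
    rw [this] at his
    cases his
  apply le_csSup
  · refine ⟨σ.requests.length, ?_⟩
    rintro k ⟨z, -, rfl⟩
    exact (Finset.card_filter_le _ _).trans (by simp)
  · refine ⟨y, ⟨?_, ?_⟩, ?_⟩
    · intro i s his
      obtain ⟨a, rfl⟩ := hy' i s his
      exact ⟨_, h.getElem? a, hx.window a s (hy a ▸ his)⟩
    · intro i j p q s t hij hp hq hs ht
      obtain ⟨a, rfl⟩ := hy' i s hs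
      obtain ⟨b, rfl⟩ := hy' j t ht
      rw [h.getElem?] at hp hq
      cases hp
      cases hq
      rw [hy] at hs ht
      exact hx.travel a b s t (fun e => hij (e ▸ rfl)) hs ht
    · rw [h.throughput_eq]
      simp only [hy]

end Labelling

/-! ### Time consumed by travelling in a star -/

section Travel

namespace StarMetric

variable {V : Type*} (S : StarMetric V)

theorem dist_of_ne {x y : V} (h : x ≠ y) : S.dist x y = S.weight x + S.weight y := by
  simp [dist, h]

theorem dist_nonneg (x y : V) : 0 ≤ S.dist x y := by
  have := S.weight_nonneg x
  have := S.weight_nonneg y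
  unfold dist
  split_ifs <;> linarith

@[simp] theorem dist_self (x : V) : S.dist x x = 0 := by simp [dist]

theorem dist_triangle (x y z : V) : S.dist x z ≤ S.dist x y + S.dist y z := by
  have := S.weight_nonneg y
  by_cases h1 : x = y
  · subst h1; simp
  by_cases h2 : y = z
  · subst h2; simp
  rw [S.dist_of_ne h1, S.dist_of_ne h2]
  have hx := S.weight_nonneg x
  have hz := S.weight_nonneg z
  by_cases h3 : x = z
  · subst h3; simp; linarith
  · rw [S.dist_of_ne h3]; linarith

end StarMetric

variable {V ι : Type*} (S : StarMetric V)

/-- Services of the requests in `I`, with nodes `v` and starting times `s`, are far enough apart. -/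
def Separated (v : ι → V) (s : ι → ℝ) (I : Finset ι) : Prop :=
  ∀ a ∈ I, ∀ b ∈ I, a ≠ b → s a + 1 + S.dist (v a) (v b) ≤ s b ∨
    s b + 1 + S.dist (v b) (v a) ≤ s a

variable {S} {v : ι → V} {s : ι → ℝ}

theorem Separated.mono {I J : Finset ι} (h : Separated S v s I) (hJ : J ⊆ I) :
    Separated S v s J := fun a ha b hb => h a (hJ ha) b (hJ hb)

theorem Separated.le_of_lt {I : Finset ι} (h : Separated S v s I) {a b : ι} (ha : a ∈ I)
    (hb : b ∈ I) (hab : s a < s b) : s a + 1 + S.dist (v a) (v b) ≤ s b := by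
  rcases h a ha b hb (by rintro rfl; exact lt_irrefl _ hab) with h | h
  · exact h
  · have := S.dist_nonneg (v b) (v a)
    linarith

variable (S) [DecidableEq V]

/-- The total weight of the nodes in `v '' J`, provided that there are at least two of them. -/
noncomputable def visitWeight (v : ι → V) (J : Finset ι) : ℝ :=
  if 2 ≤ (J.image v).card then ∑ x ∈ J.image v, S.weight x else 0

theorem visitWeight_nonneg (v : ι → V) (J : Finset ι) : 0 ≤ visitWeight S v J := by
  unfold visitWeight
  split_ifs
  · exact Finset.sum_nonneg fun x _ => S.weight_nonneg x
  · exact le_rfl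

@[simp] theorem visitWeight_empty (v : ι → V) : visitWeight S v ∅ = 0 := by
  simp [visitWeight]

variable {S}

/-- The time spent on serving and travelling is at most the length of the time interval. -/
theorem Separated.card_add_visitWeight_le_of_last [DecidableEq ι] (n : ℕ) :
    ∀ (J : Finset ι), J.card = n → Separated S v s J → ∀ l ∈ J, (∀ a ∈ J, s a ≤ s l) →
    ∀ α : ℝ, (∀ a ∈ J, α ≤ s a) →
    (J.card : ℝ) + ∑ x ∈ (J.image v).erase (v l), S.weight x ≤ s l + 1 - α ∧
    (J.card : ℝ) + visitWeight S v J ≤ s l + 1 - α := by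
  induction n with
  | zero =>
    intro J hJ _ l hl
    rw [Finset.card_eq_zero] at hJ
    simp [hJ] at hl
  | succ n ih =>
    intro J hJ hsep l hl hmax α hα
    set K := J.erase l with hK
    have hJK : J = insert l K := (Finset.insert_erase hl).symm
    have hKc : K.card = n := by rw [hK, Finset.card_erase_of_mem hl, hJ]; rfl
    have hlK : l ∉ K := Finset.notMem_erase l J
    rcases K.eq_empty_or_nonempty with hKe | hKn
    · have hJl : J = {l} := by rw [hJK, hKe]; rfl
      have := hα l hl
      rw [hJl]
      constructor
      · simp; linarith
      · simp [visitWeight]; linarith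
    · obtain ⟨l', hl', hmax'⟩ := K.exists_max_image s hKn
      have hl'J : l' ∈ J := Finset.mem_of_mem_erase hl'
      have hne : l' ≠ l := Finset.ne_of_mem_erase hl'
      have hKJ : K ⊆ J := Finset.erase_subset _ _
      obtain ⟨h1, h2⟩ := ih K hKc (hsep.mono hKJ) l' hl' hmax' α (fun a ha => hα a (hKJ ha))
      have hstep : s l' + 1 + S.dist (v l') (v l) ≤ s l := by
        rcases hsep l' hl'J l hl hne with h | h
        · exact h
        · have := S.dist_nonneg (v l) (v l')
          have := hmax l' hl'J
          linarith
      have hcard : (J.card : ℝ) = K.card + 1 := by rw [hJ, hKc]; push_cast; ring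
      have him : J.image v = insert (v l) (K.image v) := by rw [hJK, Finset.image_insert]
      have hvl' : v l' ∈ K.image v := Finset.mem_image_of_mem v hl'
      by_cases hv : v l' = v l
      · have him' : J.image v = K.image v := by
          rw [him, ← hv, Finset.insert_eq_of_mem hvl']
        have hd := S.dist_nonneg (v l') (v l)
        unfold visitWeight at h2 ⊢
        rw [him', hcard, ← hv]
        constructor <;> linarith
      · rw [S.dist_of_ne hv] at hstep
        -- The last trip pays for `v l'`, which the induction hypothesis omits, and for `v l`. So
        -- all visited leaves are paid for, and the first conjunct is the right invariant.
        have hsum : ∑ x ∈ K.image v, S.weight x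
            = ∑ x ∈ (K.image v).erase (v l'), S.weight x + S.weight (v l') :=
          (Finset.sum_erase_add _ _ hvl').symm
        have hins : ∑ x ∈ J.image v, S.weight x ≤
            S.weight (v l) + ∑ x ∈ K.image v, S.weight x := by
          rw [him]
          by_cases hm : v l ∈ K.image v
          · rw [Finset.insert_eq_of_mem hm]
            linarith [S.weight_nonneg (v l)]
          · rw [Finset.sum_insert hm]
        have herase : ∑ x ∈ (J.image v).erase (v l), S.weight x ≤ ∑ x ∈ J.image v, S.weight x :=
          Finset.sum_le_sum_of_subset_of_nonneg (Finset.erase_subset _ _)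
            fun x _ _ => S.weight_nonneg x
        have hvis : visitWeight S v J ≤ ∑ x ∈ J.image v, S.weight x := by
          unfold visitWeight
          split_ifs
          · exact le_rfl
          · exact Finset.sum_nonneg fun x _ => S.weight_nonneg x
        constructor <;> linarith

theorem Separated.card_add_visitWeight_le {J : Finset ι} (hsep : Separated S v s J)
    {α β : ℝ} (hαβ : α ≤ β) (hα : ∀ a ∈ J, α ≤ s a) (hβ : ∀ a ∈ J, s a + 1 ≤ β) :
    (J.card : ℝ) + visitWeight S v J ≤ β - α := by
  classical
  rcases J.eq_empty_or_nonempty with rfl | hJ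
  · simp [visitWeight]; linarith
  · obtain ⟨l, hl, hmax⟩ := J.exists_max_image s hJ
    have := (Separated.card_add_visitWeight_le_of_last _ J rfl hsep l hl hmax α hα).2
    have := hβ l hl
    linarith

/-- The travelling times in successive time slots add up. -/
theorem Separated.card_add_sum_visitWeight_le {I : Finset ι} (hsep : Separated S v s I)
    {α : ℝ} (hα : ∀ a ∈ I, α ≤ s a) {t : ℕ → ℝ} (ht : Monotone t) (n : ℕ) :
    ∀ β : ℝ, α ≤ β → (∀ a ∈ I, s a < t n → s a + 1 ≤ β) →
    ((I.filter (fun a => s a < t n)).card : ℝ) +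
      ∑ k ∈ Finset.range n, visitWeight S v (I.filter (fun a => t k ≤ s a ∧ s a < t (k + 1))) ≤
        β - α := by
  classical
  induction n with
  | zero =>
    intro β hαβ hβ
    have := (hsep.mono (Finset.filter_subset (fun a => s a < t 0) I)).card_add_visitWeight_le hαβ
      (fun a ha => hα a (Finset.mem_of_mem_filter a ha))
      (fun a ha => hβ a (Finset.mem_filter.1 ha).1 (Finset.mem_filter.1 ha).2)
    have h0 := visitWeight_nonneg S v (I.filter (fun a => s a < t 0))
    simp only [Finset.range_zero, Finset.sum_empty]
    linarith
  | succ n ih =>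
    intro β hαβ hβ
    set J := I.filter (fun a => t n ≤ s a ∧ s a < t (n + 1)) with hJ
    set K := I.filter (fun a => s a < t n) with hK
    have hmono := ht (Nat.le_succ n)
    have hun : I.filter (fun a => s a < t (n + 1)) = K ∪ J := by
      ext a
      simp only [hJ, hK, Finset.mem_union, Finset.mem_filter]
      constructor
      · rintro ⟨h1, h2⟩
        by_cases h : s a < t n
        · exact Or.inl ⟨h1, h⟩
        · exact Or.inr ⟨h1, not_lt.1 h, h2⟩
      · rintro (⟨h1, h2⟩ | ⟨h1, h2, h3⟩)
        · exact ⟨h1, h2.trans_le hmono⟩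
        · exact ⟨h1, h3⟩
    have hcard : ((I.filter (fun a => s a < t (n + 1))).card : ℝ) = K.card + J.card := by
      rw [hun, Finset.card_union_of_disjoint]
      · push_cast; ring
      · rw [Finset.disjoint_left]
        intro a ha hb
        exact absurd (Finset.mem_filter.1 ha).2 (not_lt.2 (Finset.mem_filter.1 hb).2.1)
    rw [Finset.sum_range_succ, ← hJ, hcard]
    rcases J.eq_empty_or_nonempty with hJe | hJn
    · have := ih β hαβ (fun a ha h => hβ a ha (h.trans_le hmono))
      rw [hJe, visitWeight_empty, Finset.card_empty, Nat.cast_zero]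
      linarith
    · obtain ⟨f, hf, hmin⟩ := J.exists_min_image s hJn
      obtain ⟨hfI, hf1, hf2⟩ := Finset.mem_filter.1 hf
      -- Cut the time at the first service `f` of the new slot rather than at `t n`, since a service
      -- may straddle the slot boundary. Travelling between the slots is discarded.
      have h1 := ih (s f) (hα f hfI) (fun a ha h => by
        have h1 := hsep.le_of_lt ha hfI (h.trans_le hf1)
        have h2 := S.dist_nonneg (v a) (v f)
        linarith)
      have h2 := (hsep.mono (Finset.filter_subset _ I) : Separated S v s J).card_add_visitWeight_le
        (α := s f) (β := β) (by have := hβ f hfI hf2; linarith) hmin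
        (fun a ha => hβ a (Finset.mem_filter.1 ha).1 (Finset.mem_filter.1 ha).2.2)
      linarith

/-- At most `n` services start within `n` time units. -/
theorem Separated.card_le_of_lt {J : Finset ι} (hsep : Separated S v s J) {α : ℝ} {n : ℕ}
    (hα : ∀ a ∈ J, α ≤ s a) (hn : ∀ a ∈ J, s a < α + n) : J.card ≤ n := by
  classical
  rcases J.eq_empty_or_nonempty with rfl | hJ
  · simp
  · obtain ⟨l, hl, hmax⟩ := J.exists_max_image s hJ
    have h1 := (Separated.card_add_visitWeight_le_of_last _ J rfl hsep l hl hmax α hα).2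
    have h2 := visitWeight_nonneg S v J
    have h3 := hn l hl
    have h4 : (J.card : ℝ) < n + 1 := by linarith
    exact Nat.lt_succ_iff.1 (by exact_mod_cast h4)

end Travel

end StarTSP
-- The adversary, and the travelling it forces on an online algorithm
namespace StarTSP

theorem IsFeasibleFamily.separated {V ι : Type*} {S : StarMetric V} {req : ι → Request V}
    {x : ι → Option ℝ} (hx : IsFeasibleFamily S req x) {I : Finset ι}
    (hI : ∀ a ∈ I, (x a).isSome) :
    Separated S (fun a => (req a).node) (fun a => (x a).getD 0) I := by
  intro a ha b hb hab
  obtain ⟨s, hs⟩ := Option.isSome_iff_exists.1 (hI a ha)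
  obtain ⟨t, ht⟩ := Option.isSome_iff_exists.1 (hI b hb)
  simpa [hs, ht] using hx.travel a b s t hab hs ht

/-- The parameters of the adversary: the home leaf, the numbers of requests per leaf in a block, the
minimum laxity, the length of the initial phase and the number of blocks. -/
structure Adversary (V : Type*) [Fintype V] where
  home : V
  mult : V → ℕ
  laxity : ℕ
  initial : ℕ
  blocks : ℕ
  laxity_pos : 1 ≤ laxity
  laxity_le : laxity ≤ initial
  mult_home_pos : 1 ≤ mult home
  sum_mult : ∑ x, mult x = 2 * mult home

namespace Adversary

variable {V : Type*} [Fintype V] (D : Adversary V)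

/-- The number of requests of a block, which is also the length of its time slot. -/
def blockSize : ℕ := 2 * D.mult D.home

/-- The number of requests at the home leaf with a late deadline. -/
def fillers : ℕ := D.blocks * D.mult D.home

/-- The beginning of the time slot of the block `k`. -/
def slot (k : ℕ) : ℕ := 1 + D.initial + k * D.blockSize

/-- The length of the final phase. -/
def final : ℕ := D.initial + D.fillers

/-- The requests that the two inputs have in common: those with an early deadline, those of the
blocks, and the fillers. -/
abbrev Label : Type _ :=
  Fin D.initial ⊕ (Fin D.blocks × (Σ x, Fin (D.mult x))) ⊕ Fin D.fillers

theorem slot_mono : Monotone D.slot := fun a b h => by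
  have := Nat.mul_le_mul_right D.blockSize h
  unfold slot
  omega

theorem slot_succ (k : ℕ) : D.slot (k + 1) = D.slot k + D.blockSize := by
  unfold slot
  ring

theorem slot_zero : D.slot 0 = 1 + D.initial := by
  unfold slot
  ring

theorem blockSize_pos : 1 ≤ D.blockSize := by
  have := D.mult_home_pos
  unfold blockSize
  omega

theorem initial_lt_slot (k : ℕ) : D.initial < D.slot k := by
  unfold slot
  omega

/-- The common requests. They are all released at time `1`. -/
def request : D.Label → Request V
  -- The request `u = 0` makes the minimum laxity exactly `laxity`.
  | .inl u => ⟨1, if u.val = 0 then 1 + D.laxity else 1 + D.initial, D.home, one_pos,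
      by split_ifs <;> omega⟩
  | .inr (.inl e) => ⟨1, D.slot (e.1 + 1), e.2.1, one_pos,
      (Nat.zero_le _).trans_lt (D.initial_lt_slot _)⟩
  | .inr (.inr _) => ⟨1, D.slot D.blocks + D.final, D.home, one_pos,
      Nat.add_pos_left ((Nat.zero_le _).trans_lt (D.initial_lt_slot _)) _⟩

/-- The requests of the flood, which make it useless to have any other request left over. -/
def floodRequest : Request V :=
  ⟨D.slot D.blocks, D.slot D.blocks + D.final, D.home,
    (Nat.zero_le _).trans_lt (D.initial_lt_slot _),
    Nat.add_pos_left ((Nat.zero_le _).trans_lt (D.initial_lt_slot _)) _⟩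

/-- The requests of the flooded input. -/
def floodedRequest : D.Label ⊕ Fin D.final → Request V :=
  Sum.elim D.request fun _ => D.floodRequest

theorem request_release (c : D.Label) : (D.request c).release = 1 := by
  rcases c with u | e | f <;> rfl

/-- The group of a request: `0` for the early ones, `k + 1` for the block `k`, and the last one
for the fillers. -/
def group : D.Label → ℕ
  | .inl _ => 0
  | .inr (.inl e) => e.1 + 1
  | .inr (.inr _) => D.blocks + 1

theorem deadline_le_slot {c : D.Label} (hc : D.group c ≤ D.blocks) :
    (D.request c).deadline ≤ D.slot (D.group c) := by
  rcases c with u | e | f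
  · have := D.laxity_le
    simp only [request, group, slot_zero]
    split_ifs <;> omega
  · exact le_rfl
  · simp [group] at hc

theorem card_label : Fintype.card D.Label = D.initial + D.blocks * D.blockSize + D.fillers := by
  simp [Label, D.sum_mult, blockSize, add_assoc]

/-- The requests due by `slot k` are exactly as many as the time units from `1` to `slot k`; hence
serving anything else in that time displaces one of them. -/
theorem card_group_le {k : ℕ} (hk : k ≤ D.blocks) :
    (Finset.univ.filter (fun c : D.Label => D.group c ≤ k)).card =
      D.initial + k * D.blockSize := by
  set f : ℕ → ℕ := fun n => if n ≤ k then 1 else 0 with hf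
  have hsum : ∑ i : Fin D.blocks, f (i + 1) = k := by
    rw [Fin.sum_univ_eq_sum_range (fun i => f (i + 1)), hf, ← Finset.card_filter]
    rw [show (Finset.range D.blocks).filter (· + 1 ≤ k) = Finset.range k by ext; simp; omega]
    simp
  calc (Finset.univ.filter (fun c : D.Label => D.group c ≤ k)).card
      = ∑ c, f (D.group c) := Finset.card_filter _ _
    _ = ∑ _u : Fin D.initial, f 0 + (∑ e : Fin D.blocks × (Σ x, Fin (D.mult x)), f (e.1 + 1) +
          ∑ _i : Fin D.fillers, f (D.blocks + 1)) := by
        rw [Fintype.sum_sum_type, Fintype.sum_sum_type]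
        rfl
    _ = D.initial + k * D.blockSize := by
        have h0 : f 0 = 1 := by simp [hf]
        have h1 : f (D.blocks + 1) = 0 := by simp [hf]; omega
        rw [Fintype.sum_prod_type, h0, h1]
        simp [← Finset.sum_mul, hsum, D.sum_mult, blockSize, mul_comm]

section Bound

variable {x : D.Label → Option ℝ}

/-- The unserved requests other than fillers. -/
noncomputable def lost (x : D.Label → Option ℝ) : Finset D.Label :=
  Finset.univ.filter (fun c => x c = none ∧ D.group c ≤ D.blocks)

theorem card_isSome_add_card_lost_le (x : D.Label → Option ℝ) :
    (Finset.univ.filter (fun c => (x c).isSome)).card + (D.lost x).card ≤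
      D.initial + D.blocks * D.blockSize + D.fillers := by
  classical
  rw [← D.card_label, ← Finset.card_union_of_disjoint]
  · exact Finset.card_le_univ _
  · rw [Finset.disjoint_left]
    intro c hc hc'
    simp only [lost, Finset.mem_filter] at hc hc'
    simp [hc'.2.1] at hc

theorem sum_card_lost_le (x : D.Label → Option ℝ) :
    ∑ k ∈ Finset.range D.blocks, ((D.lost x).filter (fun c => D.group c = k + 1)).card ≤
      (D.lost x).card := by
  classical
  rw [← Finset.card_biUnion]
  · apply Finset.card_le_card
    intro c hc
    simp only [Finset.mem_biUnion, Finset.mem_filter] at hc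
    obtain ⟨_, _, h, _⟩ := hc
    exact h
  · intro a _ b _ hab
    refine Finset.disjoint_left.2 fun c hc hc' => ?_
    simp only [Finset.mem_filter] at hc hc'
    omega

/-- Requests of the block `k` at leaves that are not visited in its slot are either lost or served
early; and whoever serves requests early loses others. -/
theorem sum_mult_le [DecidableEq V] (hx : IsFeasibleFamily S D.request x) {k : ℕ} (hk : k < D.blocks)
    {Q : Finset V} (hQ : ∀ c s, x c = some s → (D.slot k : ℝ) ≤ s → s < D.slot (k + 1) →
      (D.request c).node ∈ Q) :
    ∑ v ∈ Finset.univ.filter (· ∉ Q), D.mult v ≤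
      (D.lost x).card + ((D.lost x).filter (fun c => D.group c = k + 1)).card := by
  classical
  set J : Finset D.Label := Finset.univ.filter (fun c => ∃ s, x c = some s ∧ s < D.slot k) with hJ
  set G : Finset D.Label := Finset.univ.filter (fun c => D.group c ≤ k) with hG
  -- Capacity: services starting in `[1, slot k)` number at most `slot k - 1`.
  have hJcard : J.card ≤ D.initial + k * D.blockSize := by
    have hsep := hx.separated (I := J) (fun c hc => by
      obtain ⟨s, hs, -⟩ := (Finset.mem_filter.1 hc).2
      simp [hs])
    refine hsep.card_le_of_lt (α := 1) ?_ ?_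
    · intro c hc
      obtain ⟨s, hs, -⟩ := (Finset.mem_filter.1 hc).2
      have := (hx.window c s hs).1
      rw [D.request_release] at this
      simpa [hs] using this
    · intro c hc
      obtain ⟨s, hs, h⟩ := (Finset.mem_filter.1 hc).2
      simp only [hs, Option.getD_some]
      refine h.trans_eq ?_
      unfold slot
      push_cast
      ring
  have hdl : ∀ c s, x c = some s → D.group c ≤ D.blocks → s + 1 ≤ D.slot (D.group c) := by
    intro c s hs hc
    exact (hx.window c s hs).2.trans (by exact_mod_cast D.deadline_le_slot hc)
  have hGJ : G ⊆ (J ∩ G) ∪ D.lost x := by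
    intro c hc
    have hg := (Finset.mem_filter.1 hc).2
    rcases hxc : x c with _ | s
    · exact Finset.mem_union_right _ (by simp [lost, hxc, hg.trans hk.le])
    · refine Finset.mem_union_left _ (Finset.mem_inter.2 ⟨?_, hc⟩)
      have h1 := hdl c s hxc (hg.trans hk.le)
      have h2 : (D.slot (D.group c) : ℝ) ≤ D.slot k := by exact_mod_cast D.slot_mono hg
      exact Finset.mem_filter.2 ⟨Finset.mem_univ _, s, hxc, by linarith⟩
  -- `|J| ≤ |G|` by the two counts, so `|J \ G| ≤ |G \ J|`, and a request of `G` outside `J` is lost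
  -- because its deadline has passed.
  have hearly : (J \ G).card ≤ (D.lost x).card := by
    have h1 := Finset.card_le_card hGJ
    have h2 := Finset.card_union_le (J ∩ G) (D.lost x)
    have h3 := Finset.card_sdiff_add_card_inter J G
    have h4 := D.card_group_le hk.le
    have h5 : G.card = D.initial + k * D.blockSize := by rw [hG, ← h4]
    omega
  set Z : Finset D.Label := (({(⟨k, hk⟩ : Fin D.blocks)} : Finset _) ×ˢ
    ((Finset.univ.filter (· ∉ Q)).sigma fun v => (Finset.univ : Finset (Fin (D.mult v))))).map
      ⟨fun e => Sum.inr (Sum.inl e), fun a b h => by simpa using h⟩ with hZ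
  have hZcard : Z.card = ∑ v ∈ Finset.univ.filter (· ∉ Q), D.mult v := by
    rw [hZ, Finset.card_map, Finset.card_product, Finset.card_sigma]
    simp
  rw [← hZcard]
  refine (Finset.card_le_card (t := (J \ G) ∪ (D.lost x).filter (fun c => D.group c = k + 1))
    ?_).trans ((Finset.card_union_le _ _).trans (Nat.add_le_add_right hearly _))
  intro c hc
  simp only [hZ, Finset.mem_map, Finset.mem_product, Finset.mem_singleton, Finset.mem_sigma,
    Finset.mem_filter, Finset.mem_univ, true_and, and_true] at hc
  obtain ⟨⟨k', v, j⟩, ⟨hk', hv⟩, rfl⟩ := hc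
  dsimp only at hk' hv
  subst hk'
  change (Sum.inr (Sum.inl (⟨k, hk⟩, ⟨v, j⟩)) : D.Label) ∈ _
  have hgr : D.group (Sum.inr (Sum.inl (⟨k, hk⟩, ⟨v, j⟩))) = k + 1 := rfl
  rcases hxc : x (Sum.inr (Sum.inl (⟨k, hk⟩, ⟨v, j⟩))) with _ | s
  · refine Finset.mem_union_right _ (Finset.mem_filter.2 ⟨?_, hgr⟩)
    exact Finset.mem_filter.2 ⟨Finset.mem_univ _, hxc, by rw [hgr]; exact hk⟩
  · refine Finset.mem_union_left _ (Finset.mem_sdiff.2 ⟨?_, ?_⟩)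
    · refine Finset.mem_filter.2 ⟨Finset.mem_univ _, s, hxc, ?_⟩
      -- A request of this block served no earlier than `slot k` is served within the slot, so its
      -- leaf would lie in `Q`.
      by_contra hlt
      have h1 := hdl _ s hxc (by rw [hgr]; exact hk)
      rw [hgr] at h1
      exact hv (hQ _ s hxc (not_lt.1 hlt) (by linarith))
    · simp [hG, hgr]

end Bound

/-- The weight of the leaves other than home. -/
noncomputable def awayWeight (S : StarMetric V) : ℝ := by
  classical exact ∑ v ∈ Finset.univ.erase D.home, S.weight v

theorem awayWeight_eq [DecidableEq V] (S : StarMetric V) :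
    D.awayWeight S = ∑ v ∈ Finset.univ.erase D.home, S.weight v := by
  unfold awayWeight
  congr!

/-- Each leaf away from home that is skipped contributes at least `κ` times its weight to `q`. Home
carries as many requests as all other leaves together, so skipping home, or visiting nothing else,
already makes `q / κ` at least the away weight; thus nothing is claimed when `visitWeight` may
vanish. -/
theorem awayWeight_sub_le [DecidableEq V] {ι : Type*} {v : ι → V} {J : Finset ι} {κ q : ℝ}
    (hκ : 0 < κ) (hmult : ∀ y ≠ D.home, κ * S.weight y ≤ D.mult y)
    (hq : ((∑ y ∈ Finset.univ.filter (· ∉ J.image v), D.mult y : ℕ) : ℝ) ≤ q) :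
    D.awayWeight S - q / κ ≤ visitWeight S v J := by
  rw [D.awayWeight_eq]
  set Q := J.image v with hQ
  have hM : κ * ∑ y ∈ Finset.univ.erase D.home, S.weight y ≤ D.mult D.home := by
    have h := D.sum_mult
    rw [← Finset.sum_erase_add _ _ (Finset.mem_univ D.home)] at h
    have h' : D.mult D.home = ∑ y ∈ Finset.univ.erase D.home, D.mult y := by omega
    rw [h', Nat.cast_sum, Finset.mul_sum]
    exact Finset.sum_le_sum fun y hy => hmult y (Finset.ne_of_mem_erase hy)
  have hsmall : (D.mult D.home : ℝ) ≤ q →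
      ∑ y ∈ Finset.univ.erase D.home, S.weight y - q / κ ≤ visitWeight S v J := by
    intro h
    have h1 := visitWeight_nonneg S v J
    have h2 : ∑ y ∈ Finset.univ.erase D.home, S.weight y ≤ q / κ := by
      rw [le_div_iff₀ hκ]
      linarith
    linarith
  by_cases ho : D.home ∈ Q
  · by_cases h2 : 2 ≤ Q.card
    · have hvis : visitWeight S v J = ∑ y ∈ Q, S.weight y := by
        unfold visitWeight
        rw [if_pos h2]
      have h3 : κ * ∑ y ∈ Finset.univ.filter (· ∉ Q), S.weight y ≤ q := by
        refine le_trans ?_ hq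
        rw [Nat.cast_sum, Finset.mul_sum]
        refine Finset.sum_le_sum fun y hy => hmult y ?_
        rintro rfl
        exact (Finset.mem_filter.1 hy).2 ho
      have h4 : ∑ y ∈ Finset.univ.filter (· ∉ Q), S.weight y ≤ q / κ := by
        rw [le_div_iff₀ hκ]
        linarith
      have h5 : ∑ y ∈ Finset.univ.erase D.home, S.weight y ≤
          ∑ y ∈ Q ∪ Finset.univ.filter (· ∉ Q), S.weight y :=
        Finset.sum_le_sum_of_subset_of_nonneg (fun y _ => by
          by_cases h : y ∈ Q
          · exact Finset.mem_union_left _ h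
          · exact Finset.mem_union_right _ (Finset.mem_filter.2 ⟨Finset.mem_univ _, h⟩)) fun y _ _ => S.weight_nonneg y
      have hdisj : Disjoint Q (Finset.univ.filter (· ∉ Q)) :=
        Finset.disjoint_left.2 fun y hy hy' => (Finset.mem_filter.1 hy').2 hy
      rw [Finset.sum_union hdisj] at h5
      linarith
    · apply hsmall
      have hQo : Q = {D.home} := by
        symm
        apply Finset.eq_of_subset_of_card_le (by simpa using ho)
        simp; omega
      refine le_trans ?_ hq
      have h := D.sum_mult
      rw [← Finset.sum_erase_add _ _ (Finset.mem_univ D.home)] at h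
      have h' : Finset.univ.filter (· ∉ Q) = Finset.univ.erase D.home := by
        ext y; simp [hQo]
      rw [h']
      exact_mod_cast (by omega : D.mult D.home ≤ _)
  · apply hsmall
    refine le_trans ?_ hq
    exact_mod_cast Finset.single_le_sum (f := D.mult) (fun _ _ => Nat.zero_le _)
      (Finset.mem_filter.2 ⟨Finset.mem_univ _, ho⟩)

/-- An online algorithm that does not lose requests must travel a lot. -/
theorem card_add_card_le {κ : ℝ} (hκ : 0 < κ)
    (hmult : ∀ y ≠ D.home, κ * S.weight y ≤ D.mult y)
    {y : D.Label ⊕ Fin D.final → Option ℝ} {x : D.Label → Option ℝ}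
    (hy : IsFeasibleFamily S D.floodedRequest y) (hx : IsFeasibleFamily S D.request x)
    (hxy : ∀ c s, s < (D.slot D.blocks : ℝ) → (y (.inl c) = some s ↔ x c = some s)) :
    ((Finset.univ.filter (fun a => (y a).isSome)).card : ℝ) +
      (D.blocks + 1) / κ * (Finset.univ.filter (fun a => (x a).isSome)).card ≤
    ((D.initial + D.blocks * D.blockSize + D.final : ℕ) : ℝ) +
      (D.blocks + 1) / κ * ((D.initial + D.blocks * D.blockSize + D.fillers : ℕ) : ℝ) -
      D.blocks * D.awayWeight S := by
  classical
  set I := Finset.univ.filter (fun a => (y a).isSome) with hI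
  have hsome : ∀ a ∈ I, (y a).isSome := fun a ha => (Finset.mem_filter.1 ha).2
  have hsep := hy.separated hsome
  set v : D.Label ⊕ Fin D.final → V := fun a => (D.floodedRequest a).node with hv
  set s : D.Label ⊕ Fin D.final → ℝ := fun a => (y a).getD 0 with hs
  have hsy : ∀ a ∈ I, y a = some (s a) := by
    intro a ha
    obtain ⟨r, hr⟩ := Option.isSome_iff_exists.1 (hsome a ha)
    simp [hs, hr]
  have hlow : ∀ a ∈ I, 1 ≤ s a := by
    intro a ha
    refine le_trans ?_ (hy.window a _ (hsy a ha)).1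
    exact_mod_cast (D.floodedRequest a).release_pos
  have hup : ∀ a ∈ I, s a + 1 ≤ (D.slot D.blocks + D.final : ℕ) := by
    intro a ha
    refine (hy.window a _ (hsy a ha)).2.trans ?_
    norm_cast
    rcases a with c | f
    · by_cases hc : D.group c ≤ D.blocks
      · exact (D.deadline_le_slot hc).trans ((D.slot_mono hc).trans (Nat.le_add_right _ _))
      · rcases c with u | e | f
        · simp [group] at hc
        · exact absurd e.1.isLt (by simp [group] at hc)
        · exact le_rfl
    · exact le_rfl
  have hmono : Monotone fun k => (D.slot k : ℝ) := fun a b h => by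
    exact Nat.cast_le.2 (D.slot_mono h)
  set Y : ℕ → ℝ := fun k => visitWeight S v (I.filter (fun a => (D.slot k : ℝ) ≤ s a ∧
    s a < D.slot (k + 1))) with hY
  -- Append `final` further slots so that every service lies before the end of the last one; their
  -- visit weights are nonnegative and are dropped in `hYsum`.
  have hend : D.slot D.blocks + D.final ≤ D.slot (D.blocks + D.final) := by
    have := Nat.mul_le_mul_left D.final D.blockSize_pos
    unfold slot
    rw [add_mul]
    omega
  have htotal := hsep.card_add_sum_visitWeight_le hlow hmono (D.blocks + D.final)
    ((D.slot D.blocks + D.final : ℕ) : ℝ)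
    (by
      have : 1 ≤ D.slot D.blocks + D.final := by unfold slot; omega
      exact_mod_cast this)
    (fun a ha _ => hup a ha)
  rw [Finset.filter_true_of_mem (fun a ha => by
    have h1 := hup a ha
    have h2 : ((D.slot D.blocks + D.final : ℕ) : ℝ) ≤ D.slot (D.blocks + D.final) := by
      exact_mod_cast hend
    linarith)] at htotal
  have hYsum : ∑ k ∈ Finset.range D.blocks, Y k ≤
      ∑ k ∈ Finset.range (D.blocks + D.final), Y k :=
    Finset.sum_le_sum_of_subset_of_nonneg (Finset.range_mono (Nat.le_add_right _ _))
      fun k _ _ => visitWeight_nonneg S v _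
  have hYk : ∀ k ∈ Finset.range D.blocks, D.awayWeight S - ((D.lost x).card +
      ((D.lost x).filter (fun c => D.group c = k + 1)).card : ℝ) / κ ≤ Y k := by
    intro k hk
    have hk := Finset.mem_range.1 hk
    apply D.awayWeight_sub_le hκ hmult
    have := D.sum_mult_le hx hk (Q := (I.filter (fun a => (D.slot k : ℝ) ≤ s a ∧
      s a < D.slot (k + 1))).image v) (fun c r hr h1 h2 => by
        -- The slots of the blocks precede the flood, so what `x` visits in them `y` visits too.
        have h3 := (hxy c r (h2.trans_le (hmono hk))).2 hr
        have hsr : s (Sum.inl c) = r := by simp [hs, h3]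
        refine Finset.mem_image.2 ⟨Sum.inl c, Finset.mem_filter.2 ⟨?_, ?_⟩, rfl⟩
        · simp [hI, h3]
        · rw [hsr]
          exact ⟨h1, h2⟩)
    exact_mod_cast this
  have hYlow := Finset.sum_le_sum hYk
  rw [Finset.sum_sub_distrib, Finset.sum_const, Finset.card_range, ← Finset.sum_div,
    Finset.sum_add_distrib, Finset.sum_const, Finset.card_range, nsmul_eq_mul, nsmul_eq_mul]
    at hYlow
  -- Over all blocks, the total loss enters `blocks` times, and the losses within the respective
  -- blocks add up to at most one more total: this is the factor `blocks + 1`.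
  have hlost : ∑ k ∈ Finset.range D.blocks,
      (((D.lost x).filter (fun c => D.group c = k + 1)).card : ℝ) ≤ (D.lost x).card := by
    exact_mod_cast D.sum_card_lost_le x
  have hdiv := div_le_div_of_nonneg_right
    (add_le_add_right hlost ((D.blocks : ℝ) * (D.lost x).card)) hκ.le
  have hB : ((Finset.univ.filter (fun c => (x c).isSome)).card : ℝ) + (D.lost x).card ≤
      ((D.initial + D.blocks * D.blockSize + D.fillers : ℕ) : ℝ) := by
    exact_mod_cast D.card_isSome_add_card_lost_le x
  have hB' := mul_le_mul_of_nonneg_left hB (by positivity : (0 : ℝ) ≤ (D.blocks + 1) / κ)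
  have e1 : ((D.blocks : ℝ) * (D.lost x).card + (D.lost x).card) / κ =
      (D.blocks + 1) / κ * (D.lost x).card := by ring
  have e2 : ((D.slot D.blocks + D.final : ℕ) : ℝ) - 1 =
      ((D.initial + D.blocks * D.blockSize + D.final : ℕ) : ℝ) := by
    unfold slot
    push_cast
    ring
  rw [e1] at hdiv
  rw [e2] at htotal
  rw [mul_add] at hB'
  linarith

end Adversary

end StarTSP
-- The two inputs, and the trade-off between the throughputs on them
namespace StarTSP

namespace Adversary

variable {V : Type*} [Fintype V] (D : Adversary V)

/-- The position of a common request in the inputs. -/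
noncomputable def index (c : D.Label) : ℕ := (Fintype.equivFin D.Label c : ℕ)

theorem index_lt (c : D.Label) : D.index c < Fintype.card D.Label := Fin.isLt _

theorem index_injective : Function.Injective D.index :=
  Fin.val_injective.comp (Fintype.equivFin D.Label).injective

/-- The list of the common requests. -/
noncomputable def requestList : List (Request V) :=
  List.ofFn fun i => D.request ((Fintype.equivFin D.Label).symm i)

theorem length_requestList : D.requestList.length = Fintype.card D.Label := by
  simp [requestList]

theorem release_of_mem {q : Request V} (hq : q ∈ D.requestList) : q.release = 1 := by
  obtain ⟨i, rfl⟩ := List.mem_ofFn.1 hq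
  exact D.request_release _

theorem mem_requestList (c : D.Label) : D.request c ∈ D.requestList :=
  List.mem_ofFn.2 ⟨Fintype.equivFin D.Label c, by simp⟩

theorem requestList_index (c : D.Label) : D.requestList[D.index c]? = some (D.request c) := by
  unfold requestList index
  rw [List.getElem?_ofFn, dif_pos (Fin.isLt _)]
  simp

/-- The input that consists of the common requests. -/
noncomputable def input : Input V where
  requests := D.requestList
  sorted := List.Pairwise.imp_of_mem (R := fun _ _ => True)
    (fun ha hb _ => by rw [D.release_of_mem ha, D.release_of_mem hb])
    (List.pairwise_of_forall fun _ _ => trivial)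

/-- The input in which the flood follows the common requests. -/
noncomputable def floodedInput : Input V where
  requests := D.requestList ++ List.replicate D.final D.floodRequest
  sorted := by
    rw [List.pairwise_append]
    refine ⟨D.input.sorted, List.pairwise_replicate.2 (Or.inr le_rfl), fun a ha b _ => ?_⟩
    rw [D.release_of_mem ha]
    exact b.release_pos

theorem labelling_input : Labelling D.input D.request D.index where
  injective := D.index_injective
  getElem? := D.requestList_index
  surjective i hi := by
    rw [show D.input.requests = D.requestList from rfl, D.length_requestList] at hi
    exact ⟨(Fintype.equivFin D.Label).symm ⟨i, hi⟩, by simp [index]⟩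

/-- The positions of the requests of the flooded input. -/
noncomputable def floodedIndex : D.Label ⊕ Fin D.final → ℕ :=
  Sum.elim D.index fun i => Fintype.card D.Label + i

theorem labelling_floodedInput : Labelling D.floodedInput D.floodedRequest D.floodedIndex where
  injective := by
    rintro (a | a) (b | b) h
    · exact congrArg _ (D.index_injective h)
    · have := D.index_lt a
      simp only [floodedIndex, Sum.elim_inl, Sum.elim_inr] at h
      omega
    · have := D.index_lt b
      simp only [floodedIndex, Sum.elim_inl, Sum.elim_inr] at h
      omega
    · simp only [floodedIndex, Sum.elim_inr] at h
      exact congrArg _ (Fin.ext (by omega))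
  getElem? := by
    rintro (c | i)
    · rw [show D.floodedInput.requests[D.floodedIndex (Sum.inl c)]? =
        (D.requestList ++ List.replicate D.final D.floodRequest)[D.index c]? from rfl,
        List.getElem?_append_left (by rw [D.length_requestList]; exact D.index_lt c)]
      exact D.requestList_index c
    · rw [show D.floodedInput.requests[D.floodedIndex (Sum.inr i)]? =
        (D.requestList ++ List.replicate D.final D.floodRequest)[Fintype.card D.Label + i]?
          from rfl, List.getElem?_append_right (by rw [D.length_requestList]; omega),
        D.length_requestList, List.getElem?_replicate, if_pos (by have := i.isLt; omega)]
      rfl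
  surjective i hi := by
    simp only [floodedInput, List.length_append, D.length_requestList,
      List.length_replicate] at hi
    by_cases h : i < Fintype.card D.Label
    · exact ⟨Sum.inl ((Fintype.equivFin D.Label).symm ⟨i, h⟩), by simp [floodedIndex, index]⟩
    · exact ⟨Sum.inr ⟨i - Fintype.card D.Label, by omega⟩,
        by simp only [floodedIndex, Sum.elim_inr]; omega⟩

theorem revealed_eq {t : ℕ} (ht : t < D.slot D.blocks) :
    D.floodedInput.revealed t = D.input.revealed t := by
  have : (List.replicate D.final D.floodRequest).filter (fun q => decide (q.release ≤ t)) = [] := by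
    rw [List.filter_eq_nil_iff]
    intro q hq
    rw [(List.mem_replicate.1 hq).2]
    rw [decide_eq_true_eq]
    exact not_le.2 ht
  unfold Input.revealed floodedInput
  rw [List.filter_append, this, List.append_nil]
  rfl

theorem laxity_le_of_mem {q : Request V} (hq : q ∈ D.requestList) :
    q.release + D.laxity ≤ q.deadline := by
  obtain ⟨i, rfl⟩ := List.mem_ofFn.1 hq
  rw [D.request_release]
  have h0 := D.laxity_le
  rcases (Fintype.equivFin D.Label).symm i with u | e | f
  · simp only [request]
    split_ifs <;> omega
  · have := D.initial_lt_slot (e.1 + 1)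
    simp only [request]
    omega
  · have := D.initial_lt_slot D.blocks
    simp only [request]
    omega

theorem exists_laxity_eq : ∃ q ∈ D.requestList, q.release + D.laxity = q.deadline :=
  ⟨_, D.mem_requestList (.inl ⟨0, D.laxity_pos.trans D.laxity_le⟩), by simp [request]⟩

theorem hasMinLaxity_input : D.input.HasMinLaxity D.laxity :=
  ⟨fun _ hq => D.laxity_le_of_mem hq, D.exists_laxity_eq⟩

theorem hasMinLaxity_floodedInput : D.floodedInput.HasMinLaxity D.laxity := by
  obtain ⟨q, hq, h⟩ := D.exists_laxity_eq
  refine ⟨fun p hp => ?_, q, List.mem_append_left _ hq, h⟩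
  rcases List.mem_append.1 hp with hp | hp
  · exact D.laxity_le_of_mem hp
  · rw [(List.mem_replicate.1 hp).2]
    -- The flood has laxity `final`, which contains `initial ≥ laxity`; this is why `final` is not
    -- just `fillers`.
    have := D.laxity_le
    simp only [floodRequest, final]
    omega

variable {S : StarMetric V}

/-- The throughputs of an online algorithm on the two inputs cannot both be large. -/
theorem throughput_add_throughput_le {κ : ℝ} (hκ : 0 < κ)
    (hmult : ∀ y ≠ D.home, κ * S.weight y ≤ D.mult y) (A : OnlineAlgorithm S) :
    (throughput D.floodedInput (A.run D.floodedInput) : ℝ) +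
      (D.blocks + 1) / κ * throughput D.input (A.run D.input) ≤
    ((D.initial + D.blocks * D.blockSize + D.final : ℕ) : ℝ) +
      (D.blocks + 1) / κ * ((D.initial + D.blocks * D.blockSize + D.fillers : ℕ) : ℝ) -
      D.blocks * D.awayWeight S := by
  rw [D.labelling_input.throughput_eq, D.labelling_floodedInput.throughput_eq]
  refine D.card_add_card_le hκ hmult
    (D.labelling_floodedInput.isFeasibleFamily (A.feasible _))
    (D.labelling_input.isFeasibleFamily (A.feasible _)) fun c s hs => ?_
  have hpos := D.initial_lt_slot D.blocks
  -- Up to time `slot blocks - 1` the inputs look alike, which fixes everything started before `slot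
  -- blocks`.
  refine A.nonanticipative _ _ (D.slot D.blocks - 1) (D.revealed_eq (by omega)) _ _ ?_
  rw [Nat.cast_sub (by omega)]
  push_cast
  linarith

theorem card_isSome_eq {β : Type*} (x : D.Label → Option β) :
    (Finset.univ.filter (fun c => (x c).isSome)).card =
      ∑ u, (if (x (.inl u)).isSome then 1 else 0) +
      (∑ k, ∑ v, ∑ j, (if (x (.inr (.inl (k, ⟨v, j⟩)))).isSome then 1 else 0) +
        ∑ f, (if (x (.inr (.inr f))).isSome then 1 else 0)) := by
  rw [Finset.card_filter, Fintype.sum_sum_type, Fintype.sum_sum_type, Fintype.sum_prod_type]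
  simp only [Fintype.sum_sigma]

theorem slot_blocks : D.slot D.blocks = 1 + D.initial + 2 * D.fillers := by
  unfold slot blockSize fillers
  ring

theorem mul_mult_add_lt (k : Fin D.blocks) (j : Fin (D.mult D.home)) :
    (k : ℕ) * D.mult D.home + j < D.fillers := by
  have h1 : ((k : ℕ) + 1) * D.mult D.home ≤ D.blocks * D.mult D.home :=
    Nat.mul_le_mul_right _ k.isLt
  have h2 := j.isLt
  unfold fillers
  rw [add_mul] at h1
  omega

/-! ### Staying at home on the flooded input -/

section FloodedOptimum

variable [DecidableEq V]

/-- A schedule for the flooded input that never leaves home and is never idle. -/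
def floodedStart : D.Label ⊕ Fin D.final → Option ℕ
  | .inl (.inl u) => some (1 + u)
  | .inl (.inr (.inl e)) =>
      if e.2.1 = D.home then some (1 + D.initial + e.1 * D.mult D.home + e.2.2) else none
  | .inl (.inr (.inr f)) => some (1 + D.initial + D.fillers + f)
  | .inr i => some (D.slot D.blocks + i)

theorem floodedStart_window {a : D.Label ⊕ Fin D.final} {n : ℕ}
    (h : D.floodedStart a = some n) :
    (D.floodedRequest a).node = D.home ∧ (D.floodedRequest a).release ≤ n ∧
      n + 1 ≤ (D.floodedRequest a).deadline := by
  rcases a with (u | ⟨k, v, j⟩ | f) | i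
  · simp only [floodedStart, Option.some.injEq] at h
    refine ⟨rfl, ?_, ?_⟩
    · simp only [floodedRequest, Sum.elim_inl, request]
      omega
    · have := u.isLt
      have := D.laxity_pos
      simp only [floodedRequest, Sum.elim_inl, request]
      split_ifs <;> omega
  · simp only [floodedStart] at h
    split_ifs at h with hv
    subst hv
    simp only [Option.some.injEq] at h
    refine ⟨rfl, ?_, ?_⟩
    · simp only [floodedRequest, Sum.elim_inl, request]
      omega
    · have h1 := j.isLt
      simp only [floodedRequest, Sum.elim_inl, request, slot, blockSize]
      rw [← h]
      nlinarith [Nat.zero_le ((k : ℕ) * D.mult D.home)]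
  · simp only [floodedStart, Option.some.injEq] at h
    have := D.slot_blocks
    have := f.isLt
    refine ⟨rfl, ?_, ?_⟩
    · simp only [floodedRequest, Sum.elim_inl, request]
      omega
    · simp only [floodedRequest, Sum.elim_inl, request]
      omega
  · simp only [floodedStart, Option.some.injEq] at h
    have := i.isLt
    refine ⟨rfl, ?_, ?_⟩
    · simp only [floodedRequest, Sum.elim_inr, floodRequest]
      omega
    · simp only [floodedRequest, Sum.elim_inr, floodRequest]
      omega

theorem floodedStart_injective {a b : D.Label ⊕ Fin D.final} {n : ℕ}
    (ha : D.floodedStart a = some n) (hb : D.floodedStart b = some n) : a = b := by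
  have hR := D.slot_blocks
  -- Uniqueness of quotient and remainder modulo `mult home`: distinct home requests of the blocks
  -- get distinct times.
  have key : ∀ {k k' j j' : ℕ}, j < D.mult D.home → j' < D.mult D.home →
      k * D.mult D.home + j = k' * D.mult D.home + j' → k = k' ∧ j = j' := by
    intro k k' j j' hj hj' h
    have h1 := congrArg (· / D.mult D.home) h
    have h2 := congrArg (· % D.mult D.home) h
    simp only [Nat.mul_add_mod_self_right, Nat.mod_eq_of_lt hj, Nat.mod_eq_of_lt hj'] at h2
    subst h2
    exact ⟨Nat.eq_of_mul_eq_mul_right (by omega) (Nat.add_right_cancel h), rfl⟩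
  rcases a with (u | ⟨k, v, j⟩ | f) | i <;> rcases b with (u' | ⟨k', v', j'⟩ | f') | i' <;>
    simp only [floodedStart] at ha hb <;> (try split_ifs at ha with hv) <;>
    (try split_ifs at hb with hv') <;> (try subst hv) <;> (try subst hv') <;>
    simp only [Option.some.injEq] at ha hb <;> (try have hu := u.isLt) <;>
    (try have hu' := u'.isLt) <;> (try have hf := f.isLt) <;> (try have hf' := f'.isLt) <;>
    (try have hk := D.mul_mult_add_lt k j) <;> (try have hk' := D.mul_mult_add_lt k' j') <;>
    (try omega)
  · rw [show u = u' from Fin.ext (by omega)]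
  · obtain ⟨h1, h2⟩ := key (k := k) (k' := k') j.isLt j'.isLt (by omega)
    rw [show k = k' from Fin.ext h1, show j = j' from Fin.ext h2]
  · rw [show f = f' from Fin.ext (by omega)]
  · rw [show i = i' from Fin.ext (by omega)]

theorem le_opt_floodedInput :
    D.initial + D.blocks * D.blockSize + D.final ≤ opt S D.floodedInput := by
  have hfeas : IsFeasibleFamily S D.floodedRequest
      (fun a => (D.floodedStart a).map (Nat.cast : ℕ → ℝ)) := by
    constructor
    · intro a s hs
      obtain ⟨n, hn, rfl⟩ := Option.map_eq_some_iff.1 hs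
      obtain ⟨-, h1, h2⟩ := D.floodedStart_window hn
      exact ⟨by exact_mod_cast h1, by exact_mod_cast h2⟩
    · intro a b s t hab hs ht
      obtain ⟨n, hn, rfl⟩ := Option.map_eq_some_iff.1 hs
      obtain ⟨n', hn', rfl⟩ := Option.map_eq_some_iff.1 ht
      rw [(D.floodedStart_window hn).1, (D.floodedStart_window hn').1, S.dist_self, add_zero,
        add_zero]
      rcases lt_trichotomy n n' with h | h | h
      · exact Or.inl (by exact_mod_cast h)
      · subst h
        exact absurd (D.floodedStart_injective hn hn') hab
      · exact Or.inr (by exact_mod_cast h)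
  refine le_trans (le_of_eq ?_) (D.labelling_floodedInput.card_le_opt hfeas)
  simp only [Option.isSome_map]
  have h1 : (Finset.univ.filter (fun a => (D.floodedStart a).isSome)).card =
      (Finset.univ.filter (fun c => (D.floodedStart (.inl c)).isSome)).card + D.final := by
    rw [Finset.card_filter, Fintype.sum_sum_type, ← Finset.card_filter]
    simp [floodedStart]
  have h2 : ∀ v : V, (∑ _j : Fin (D.mult v), if v = D.home then 1 else 0) =
      if v = D.home then D.mult v else 0 := by
    intro v
    split_ifs <;> simp
  rw [h1, D.card_isSome_eq]
  simp only [floodedStart, Option.isSome_some, Option.isSome_ite, h2]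
  simp only [Finset.sum_ite_eq', Finset.mem_univ, if_true, Finset.sum_const, Finset.card_univ,
    Fintype.card_fin, smul_eq_mul, mul_one]
  unfold blockSize fillers
  ring

end FloodedOptimum

end Adversary

end StarTSP
-- Touring the star on the input without flood
namespace StarTSP

/-- Intervals of given lengths can be arranged one after the other. -/
theorem exists_consecutive_intervals {V : Type*} [DecidableEq V] (X : Finset V) (l : V → ℝ)
    (hl : ∀ x, 0 ≤ l x) :
    ∃ b : V → ℝ, (∀ x ∈ X, 0 ≤ b x ∧ b x + l x ≤ ∑ y ∈ X, l y) ∧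
      ∀ x ∈ X, ∀ y ∈ X, x ≠ y → b x + l x ≤ b y ∨ b y + l y ≤ b x := by
  induction X using Finset.induction_on with
  | empty => exact ⟨fun _ => 0, by simp, by simp⟩
  | insert a X ha ih =>
    obtain ⟨b, h1, h2⟩ := ih
    have hsum : 0 ≤ ∑ y ∈ X, l y := Finset.sum_nonneg fun y _ => hl y
    have hb : ∀ x ∈ X, Function.update b a (∑ y ∈ X, l y) x = b x := fun x hx =>
      Function.update_of_ne (by rintro rfl; exact ha hx) _ _
    refine ⟨Function.update b a (∑ y ∈ X, l y), ?_, ?_⟩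
    · intro x hx
      rw [Finset.sum_insert ha]
      rcases Finset.mem_insert.1 hx with rfl | hx
      · rw [Function.update_self]
        exact ⟨hsum, by linarith⟩
      · rw [hb x hx]
        have h := h1 x hx
        have := hl a
        exact ⟨h.1, by linarith [h.2]⟩
    · intro x hx y hy hxy
      rcases Finset.mem_insert.1 hx with hx | hx <;> rcases Finset.mem_insert.1 hy with hy | hy
      · exact absurd (hx.trans hy.symm) hxy
      · rw [hx, Function.update_self, hb y hy]
        exact Or.inr (h1 y hy).2
      · rw [hy, Function.update_self, hb x hx]
        exact Or.inl (h1 x hx).2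
      · rw [hb x hx, hb y hy]
        exact h2 x hx y hy hxy

namespace Adversary

variable {V : Type*} [Fintype V] [DecidableEq V] (D : Adversary V) {S : StarMetric V}

theorem sum_erase_mult : ∑ v ∈ Finset.univ.erase D.home, D.mult v = D.mult D.home := by
  have h := D.sum_mult
  rw [← Finset.sum_erase_add _ _ (Finset.mem_univ D.home)] at h
  omega

theorem totalWeight_eq (S : StarMetric V) :
    S.totalWeight = D.awayWeight S + S.weight D.home := by
  rw [D.awayWeight_eq, StarMetric.totalWeight,
    ← Finset.sum_erase_add _ _ (Finset.mem_univ D.home)]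

/-- The schedule that makes a tour of the star in the slot of each block, at the cost of `τ`
requests at home. -/
noncomputable def tourStart (S : StarMetric V) (τ : ℕ) (b : V → ℝ) : D.Label → Option ℝ
  | .inl u => some (1 + (u : ℕ))
  | .inr (.inl e) =>
      if e.2.1 = D.home then
        if (e.2.2 : ℕ) + τ < D.mult D.home then some (D.slot e.1 + (e.2.2 : ℕ)) else none
      else some (D.slot e.1 + (D.mult D.home - τ) + S.weight D.home + b e.2.1 +
        S.weight e.2.1 + (e.2.2 : ℕ))
  | .inr (.inr f) => some (D.slot D.blocks + (f : ℕ))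

/-- The beginning of the time slot of a group. -/
def groupBegin (g : ℕ) : ℕ := if g = 0 then 1 else D.slot (g - 1)

variable {D} {τ : ℕ} {b : V → ℝ}

/-- The server can be at home at the start of the slot of each group and, except for the fillers,
again at its end. In a block, home takes `M - τ` units and the excursion `M + 2 * w(S)`, where `M =
mult home`; this fits into `2 * M` because `τ ≥ 2 * w(S)`. -/
theorem tourStart_guard (hτ : 2 * S.totalWeight ≤ τ) (hτM : τ ≤ D.mult D.home)
    (hb : ∀ x ≠ D.home, 0 ≤ b x ∧
      b x + (D.mult x + 2 * S.weight x) ≤ D.mult D.home + 2 * D.awayWeight S)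
    {c : D.Label} {s : ℝ} (hs : D.tourStart S τ b c = some s) :
    (D.groupBegin (D.group c) : ℝ) + S.dist D.home (D.request c).node ≤ s ∧
      (D.group c ≤ D.blocks →
        s + 1 + S.dist (D.request c).node D.home ≤ D.slot (D.group c)) := by
  have hW := D.totalWeight_eq S
  have hτM' : (τ : ℝ) ≤ D.mult D.home := by exact_mod_cast hτM
  rcases c with u | ⟨k, v, j⟩ | f
  · simp only [tourStart, Option.some.injEq] at hs
    have hu : ((u : ℕ) : ℝ) + 1 ≤ D.initial := by exact_mod_cast u.isLt
    have hu0 : (0 : ℝ) ≤ (u : ℕ) := Nat.cast_nonneg _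
    simp only [group, groupBegin, request, S.dist_self, D.slot_zero, if_true]
    push_cast
    exact ⟨by linarith, fun _ => by linarith⟩
  · have hj : ((j : ℕ) : ℝ) + 1 ≤ D.mult v := by exact_mod_cast j.isLt
    have hj0 : (0 : ℝ) ≤ (j : ℕ) := Nat.cast_nonneg _
    have hslot : (D.slot ((k : ℕ) + 1) : ℝ) = D.slot k + 2 * D.mult D.home := by
      rw [D.slot_succ, blockSize]
      push_cast
      ring
    simp only [tourStart] at hs
    simp only [group, groupBegin, request, Nat.add_sub_cancel, Nat.succ_ne_zero, if_false, hslot]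
    split_ifs at hs with hv hjτ
    · subst hv
      simp only [Option.some.injEq] at hs
      rw [S.dist_self]
      exact ⟨by linarith, fun _ => by linarith⟩
    · simp only [Option.some.injEq] at hs
      obtain ⟨h1, h2⟩ := hb v hv
      rw [S.dist_of_ne hv, S.dist_of_ne (Ne.symm hv)]
      exact ⟨by linarith, fun _ => by linarith⟩
  · simp only [tourStart, Option.some.injEq] at hs
    have hf0 : (0 : ℝ) ≤ (f : ℕ) := Nat.cast_nonneg _
    simp only [group, groupBegin, request, Nat.add_sub_cancel, Nat.succ_ne_zero, if_false,
      S.dist_self]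
    exact ⟨by linarith, fun h => by omega⟩

theorem tourStart_travel_of_group_eq
    (hb : ∀ x ≠ D.home, 0 ≤ b x)
    (hbb : ∀ x ≠ D.home, ∀ y ≠ D.home, x ≠ y → b x + (D.mult x + 2 * S.weight x) ≤ b y ∨
      b y + (D.mult y + 2 * S.weight y) ≤ b x)
    {c d : D.Label} {s t : ℝ} (hcd : c ≠ d) (hg : D.group c = D.group d)
    (hs : D.tourStart S τ b c = some s) (ht : D.tourStart S τ b d = some t) :
    s + 1 + S.dist (D.request c).node (D.request d).node ≤ t ∨
      t + 1 + S.dist (D.request d).node (D.request c).node ≤ s := by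
  have hnat : ∀ {m n : ℕ}, m ≠ n → (m : ℝ) + 1 ≤ n ∨ (n : ℝ) + 1 ≤ m := by
    intro m n h
    rcases lt_or_gt_of_ne h with h | h
    · exact Or.inl (by exact_mod_cast h)
    · exact Or.inr (by exact_mod_cast h)
  rcases c with u | ⟨k, v, j⟩ | f <;> rcases d with u' | ⟨k', v', j'⟩ | f' <;>
    simp only [group] at hg
  · simp only [tourStart, Option.some.injEq] at hs ht
    simp only [request, S.dist_self]
    rcases hnat (fun h : (u : ℕ) = u' => hcd (by rw [Fin.ext h])) with h | h
    · exact Or.inl (by linarith)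
    · exact Or.inr (by linarith)
  · omega
  · omega
  · omega
  · have hk : k = k' := Fin.ext (by omega)
    subst hk
    simp only [tourStart] at hs ht
    simp only [request]
    have hj : ((j : ℕ) : ℝ) + 1 ≤ D.mult v := by exact_mod_cast j.isLt
    have hj0 : (0 : ℝ) ≤ (j : ℕ) := Nat.cast_nonneg _
    have hj' : ((j' : ℕ) : ℝ) + 1 ≤ D.mult v' := by exact_mod_cast j'.isLt
    have hj0' : (0 : ℝ) ≤ (j' : ℕ) := Nat.cast_nonneg _
    by_cases hvv : v = v'
    · subst hvv
      rw [S.dist_self]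
      have hjj := hnat (fun h : (j : ℕ) = j' => hcd (by rw [Fin.ext h]))
      split_ifs at hs ht
      all_goals
        simp only [Option.some.injEq] at hs ht
        rcases hjj with h | h
        · exact Or.inl (by linarith)
        · exact Or.inr (by linarith)
    · rw [S.dist_of_ne hvv, S.dist_of_ne (Ne.symm hvv)]
      by_cases hv : v = D.home <;> by_cases hv' : v' = D.home
      · exact absurd (hv.trans hv'.symm) hvv
      · rw [if_pos hv] at hs
        rw [if_neg hv'] at ht
        split_ifs at hs with hjτ
        simp only [Option.some.injEq] at hs ht
        have h1 : ((j : ℕ) : ℝ) + τ + 1 ≤ D.mult D.home := by exact_mod_cast hjτ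
        have h2 := hb v' hv'
        rw [hv]
        exact Or.inl (by linarith)
      · rw [if_neg hv] at hs
        rw [if_pos hv'] at ht
        split_ifs at ht with hjτ
        simp only [Option.some.injEq] at hs ht
        have h1 : ((j' : ℕ) : ℝ) + τ + 1 ≤ D.mult D.home := by exact_mod_cast hjτ
        have h2 := hb v hv
        rw [hv']
        exact Or.inr (by linarith)
      · rw [if_neg hv] at hs
        rw [if_neg hv'] at ht
        simp only [Option.some.injEq] at hs ht
        rcases hbb v hv v' hv' hvv with h | h
        · exact Or.inl (by linarith)
        · exact Or.inr (by linarith)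
  · omega
  · omega
  · omega
  · simp only [tourStart, Option.some.injEq] at hs ht
    simp only [request, S.dist_self]
    rcases hnat (fun h : (f : ℕ) = f' => hcd (by rw [Fin.ext h])) with h | h
    · exact Or.inl (by linarith)
    · exact Or.inr (by linarith)

theorem isFeasibleFamily_tourStart (hτ : 2 * S.totalWeight ≤ τ) (hτM : τ ≤ D.mult D.home)
    (hb : ∀ x ≠ D.home, 0 ≤ b x ∧
      b x + (D.mult x + 2 * S.weight x) ≤ D.mult D.home + 2 * D.awayWeight S)
    (hbb : ∀ x ≠ D.home, ∀ y ≠ D.home, x ≠ y → b x + (D.mult x + 2 * S.weight x) ≤ b y ∨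
      b y + (D.mult y + 2 * S.weight y) ≤ b x) :
    IsFeasibleFamily S D.request (D.tourStart S τ b) := by
  -- Services of different groups are compatible by the triangle inequality through home.
  have hlt : ∀ {c d : D.Label} {s t : ℝ}, D.group c < D.group d →
      D.tourStart S τ b c = some s → D.tourStart S τ b d = some t →
      s + 1 + S.dist (D.request c).node (D.request d).node ≤ t := by
    intro c d s t hcd hs ht
    have hd : D.group d ≤ D.blocks + 1 := by
      rcases d with u | e | f
      · simp [group]
      · have := e.1.isLt
        simp only [group]
        omega
      · exact le_rfl
    have h1 := (tourStart_guard hτ hτM hb hs).2 (by omega)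
    have h2 := (tourStart_guard hτ hτM hb ht).1
    have h3 : (D.slot (D.group c) : ℝ) ≤ D.groupBegin (D.group d) := by
      unfold groupBegin
      rw [if_neg (by omega)]
      exact_mod_cast D.slot_mono (by omega)
    have h4 := S.dist_triangle (D.request c).node D.home (D.request d).node
    linarith
  constructor
  · intro c s hs
    have h1 := tourStart_guard hτ hτM hb hs
    have h2 := S.dist_nonneg D.home (D.request c).node
    have h3 := S.dist_nonneg (D.request c).node D.home
    have h4 : (1 : ℝ) ≤ D.groupBegin (D.group c) := by
      unfold groupBegin
      split_ifs
      · simp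
      · have := D.initial_lt_slot (D.group c - 1)
        exact_mod_cast (by omega : 1 ≤ D.slot (D.group c - 1))
    rw [D.request_release]
    refine ⟨by push_cast; linarith, ?_⟩
    rcases c with u | e | f
    · have h5 := u.isLt
      have h6 := D.laxity_pos
      simp only [tourStart, Option.some.injEq] at hs
      rw [← hs]
      simp only [request]
      norm_cast
      split_ifs <;> omega
    · have h5 := h1.2 (by have := e.1.isLt; simp only [group]; omega)
      exact le_trans (by linarith) h5
    · have h5 := f.isLt
      simp only [tourStart, Option.some.injEq] at hs
      rw [← hs]
      simp only [request, final]
      norm_cast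
      omega
  · intro c d s t hcd hs ht
    rcases lt_trichotomy (D.group c) (D.group d) with h | h | h
    · exact Or.inl (hlt h hs ht)
    · exact tourStart_travel_of_group_eq (fun x hx => (hb x hx).1) hbb hcd h hs ht
    · exact Or.inr (hlt h ht hs)

theorem le_opt_input (hτ : 2 * S.totalWeight ≤ τ) (hτM : τ ≤ D.mult D.home) :
    D.initial + D.blocks * D.blockSize + D.fillers ≤ opt S D.input + D.blocks * τ := by
  -- Leaf `x` receives an interval for its services together with the way from the centre and back.
  obtain ⟨b, hb, hbb⟩ := exists_consecutive_intervals (Finset.univ.erase D.home)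
    (fun x => (D.mult x : ℝ) + 2 * S.weight x)
    (fun x => by have := S.weight_nonneg x; positivity)
  have hfeas : IsFeasibleFamily S D.request (D.tourStart S τ b) := by
    refine isFeasibleFamily_tourStart hτ hτM (fun x hx => ?_) fun x hx y hy => ?_
    · have h := hb x (by simpa using hx)
      rw [Finset.sum_add_distrib, ← Finset.mul_sum, ← D.awayWeight_eq, ← Nat.cast_sum,
        D.sum_erase_mult] at h
      exact h
    · exact hbb x (by simpa using hx) y (by simpa using hy)
  refine le_trans (le_trans (le_of_eq ?_) (Nat.add_le_add_right
    (D.labelling_input.card_le_opt hfeas) (D.blocks * τ))) le_rfl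
  have h1 : ∀ k : Fin D.blocks, ∀ v : V, (∑ j : Fin (D.mult v),
      if (D.tourStart S τ b (.inr (.inl (k, ⟨v, j⟩)))).isSome then 1 else 0) =
      if v = D.home then D.mult D.home - τ else D.mult v := by
    intro k v
    by_cases hv : v = D.home
    · subst hv
      simp only [tourStart, if_true, Option.isSome_ite]
      rw [Fin.sum_univ_eq_sum_range (fun j => if j + τ < D.mult D.home then 1 else 0),
        ← Finset.card_filter, show (Finset.range (D.mult D.home)).filter
        (· + τ < D.mult D.home) = Finset.range (D.mult D.home - τ) by ext; simp; omega]
      simp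
    · simp [tourStart, hv]
  have h2 : ∑ v, (if v = D.home then D.mult D.home - τ else D.mult v) + τ = D.blockSize := by
    rw [← Finset.sum_erase_add _ _ (Finset.mem_univ D.home), if_pos rfl,
      Finset.sum_congr rfl fun v hv => if_neg (Finset.ne_of_mem_erase hv), D.sum_erase_mult,
      blockSize]
    omega
  rw [D.card_isSome_eq, ← h2]
  simp only [h1]
  simp only [tourStart, Option.isSome_some, if_true, Finset.sum_const, Finset.card_univ,
    Fintype.card_fin, smul_eq_mul, mul_one]
  ring

end Adversary

end StarTSP
-- Choice of the parameters, randomization and the final estimate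
namespace StarTSP

universe u v

section Existence

variable {V : Type u} [Fintype V] [Nontrivial V] {S : StarMetric V}

open Classical in
/-- An adversary whose blocks have about `12 * (m + 1) * w x` requests at each leaf `x` of weight
`w x`, except at the lightest leaf, which is its home. -/
theorem exists_adversary (hS : ∀ x y : V, x ≠ y → 1 ≤ S.dist x y) {L H m : ℕ} (hL : 1 ≤ L)
    (hLH : L ≤ H) (hm : 1 ≤ m) :
    ∃ D : Adversary V, D.laxity = L ∧ D.initial = H ∧ D.blocks = m ∧
      1 / 2 ≤ D.awayWeight S ∧ D.awayWeight S ≤ S.totalWeight ∧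
      S.totalWeight ≤ 2 * D.awayWeight S ∧
      (∀ y ≠ D.home, 12 * ((m : ℝ) + 1) * S.weight y ≤ D.mult y) ∧
      12 * ((m : ℝ) + 1) * D.awayWeight S ≤ D.mult D.home ∧
      (D.mult D.home : ℝ) ≤ 26 * m * D.awayWeight S := by
  -- With the lightest leaf as home, all other weights are at least `1 / 2`, and the away weight is
  -- at least half of the total.
  obtain ⟨o, -, ho⟩ := Finset.univ.exists_min_image S.weight Finset.univ_nonempty
  have hm' : (1 : ℝ) ≤ m := by exact_mod_cast hm
  have hhalf : ∀ y ≠ o, 1 / 2 ≤ S.weight y := by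
    intro y hy
    have h1 := hS y o hy
    rw [S.dist_of_ne hy] at h1
    have h2 := ho y (Finset.mem_univ y)
    linarith
  obtain ⟨z, hz⟩ := exists_ne o
  have hzmem : z ∈ Finset.univ.erase o := Finset.mem_erase.2 ⟨hz, Finset.mem_univ z⟩
  set W' := ∑ y ∈ Finset.univ.erase o, S.weight y with hW'
  have hzW : S.weight z ≤ W' :=
    Finset.single_le_sum (fun y _ => S.weight_nonneg y) hzmem
  set f : V → ℕ := fun y => ⌈12 * ((m : ℝ) + 1) * S.weight y⌉₊ with hf
  set M := ∑ y ∈ Finset.univ.erase o, f y with hM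
  have hMlow : 12 * ((m : ℝ) + 1) * W' ≤ M := by
    rw [hM, hW', Nat.cast_sum, Finset.mul_sum]
    exact Finset.sum_le_sum fun y _ => Nat.le_ceil _
  -- `12 * (m + 1) ≤ 24 * m`, and rounding up adds at most `1 ≤ 2 * m * weight y`.
  have hMup : (M : ℝ) ≤ 26 * m * W' := by
    rw [hM, hW', Nat.cast_sum, Finset.mul_sum]
    refine Finset.sum_le_sum fun y hy => ?_
    have h1 := hhalf y (Finset.ne_of_mem_erase hy)
    have h2 := Nat.ceil_lt_add_one (a := 12 * ((m : ℝ) + 1) * S.weight y) (by positivity)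
    nlinarith
  have hhalf' : 1 / 2 ≤ W' := (hhalf z hz).trans hzW
  have hMpos : 1 ≤ M := by
    have : (0 : ℝ) < M := by
      refine lt_of_lt_of_le ?_ hMlow
      positivity
    exact_mod_cast this
  let D : Adversary V :=
    { home := o
      mult := Function.update f o M
      laxity := L
      initial := H
      blocks := m
      laxity_pos := hL
      laxity_le := hLH
      mult_home_pos := by rwa [Function.update_self]
      sum_mult := by
        rw [← Finset.sum_erase_add _ _ (Finset.mem_univ o), Function.update_self,
          Finset.sum_congr rfl fun y hy => Function.update_of_ne (Finset.ne_of_mem_erase hy) _ _]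
        omega }
  have hDW : D.awayWeight S = W' := D.awayWeight_eq S
  have hDM : D.mult D.home = M := Function.update_self o M f
  have htot := D.totalWeight_eq S
  have how : S.weight D.home ≤ W' := (ho z (Finset.mem_univ z)).trans hzW
  have how0 := S.weight_nonneg D.home
  refine ⟨D, rfl, rfl, rfl, ?_, ?_, ?_, ?_, ?_, ?_⟩
  · rwa [hDW]
  · linarith
  · linarith
  · intro y hy
    rw [show D.mult y = f y from Function.update_of_ne hy M f]
    exact Nat.le_ceil _
  · rwa [hDW, hDM]
  · rwa [hDW, hDM]

/-- Two inputs on which the throughputs of an online algorithm cannot both be close to optimal. -/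
theorem exists_hard_inputs (hS : ∀ x y : V, x ≠ y → 1 ≤ S.dist x y) {L H m : ℕ} (hL : 1 ≤ L)
    (hLH : L ≤ H) (hm : 1 ≤ m) :
    ∃ (σ τ : Input V) (w : ℝ), σ.HasMinLaxity L ∧ τ.HasMinLaxity L ∧
      1 / 2 ≤ w ∧ w ≤ S.totalWeight ∧ S.totalWeight ≤ 2 * w ∧
      ∀ A : OnlineAlgorithm S,
        (throughput σ (A.run σ) : ℝ) + throughput τ (A.run τ) / 12 ≤
          min ((opt S σ : ℝ) + opt S τ / 12 - m * w / 2) (25 / 12 * H + 169 / 2 * m ^ 2 * w) := by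
  classical
  obtain ⟨D, rfl, rfl, rfl, hhalf, hle, hge, hmult, hMlow, hMup⟩ := exists_adversary hS hL hLH hm
  have hm' : (1 : ℝ) ≤ D.blocks := by exact_mod_cast hm
  refine ⟨D.floodedInput, D.input, D.awayWeight S, D.hasMinLaxity_floodedInput,
    D.hasMinLaxity_input, hhalf, hle, hge, fun A => ?_⟩
  set w := D.awayWeight S with hw
  have hκ : (0 : ℝ) < 12 * (D.blocks + 1) := by positivity
  have hA := D.throughput_add_throughput_le hκ hmult A
  -- The factor `12` balances the tour: it gives up at most `6 * w` per block, which at rate `1 /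
  -- 12` is half of the forced travelling `w`. The other half is the gap.
  rw [show ((D.blocks : ℝ) + 1) / (12 * (D.blocks + 1)) = 1 / 12 by field_simp] at hA
  set τ := ⌈2 * S.totalWeight⌉₊ with hτ
  have hW0 : 0 ≤ 2 * S.totalWeight := by linarith
  have hτ1 : 2 * S.totalWeight ≤ τ := Nat.le_ceil _
  have hτ2 : (τ : ℝ) ≤ 6 * w := by
    have := Nat.ceil_lt_add_one hW0
    linarith
  have hτM : τ ≤ D.mult D.home := by
    have : (τ : ℝ) ≤ D.mult D.home := by nlinarith
    exact_mod_cast this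
  have hopt1 : ((D.initial + D.blocks * D.blockSize + D.final : ℕ) : ℝ) ≤
      opt S D.floodedInput := by exact_mod_cast D.le_opt_floodedInput
  have hopt2 : ((D.initial + D.blocks * D.blockSize + D.fillers : ℕ) : ℝ) ≤
      opt S D.input + D.blocks * τ := by exact_mod_cast D.le_opt_input hτ1 hτM
  have hbτ : (D.blocks : ℝ) * τ ≤ D.blocks * (6 * w) :=
    mul_le_mul_of_nonneg_left hτ2 (by positivity)
  refine le_min (by linarith) ?_
  have hbM : (D.blocks : ℝ) * D.mult D.home ≤ D.blocks * (26 * D.blocks * w) :=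
    mul_le_mul_of_nonneg_left hMup (by positivity)
  have hbw : 0 ≤ (D.blocks : ℝ) * w := by positivity
  simp only [Adversary.final, Adversary.fillers, Adversary.blockSize] at hA
  push_cast at hA
  linarith

end Existence

/-- A lower bound on the competitive ratio from a throughput bounded in two ways. -/
theorem le_ratio_of_throughput_le {ρ a b p q g B : ℝ} (ha : 0 ≤ a) (hb : 0 ≤ b) (hg : 0 < g)
    (hp : p ≤ ρ * a) (hq : q ≤ ρ * b) (h : a + b / 12 ≤ min (p + q / 12 - g) B) :
    1 ≤ ρ ∧ g ≤ (ρ - 1) * B := by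
  have h1 := h.trans (min_le_left _ _)
  have h2 := h.trans (min_le_right _ _)
  have h3 : g ≤ (ρ - 1) * (a + b / 12) := by linarith
  have h4 : 0 < ρ - 1 := by
    by_contra hneg
    have : (ρ - 1) * (a + b / 12) ≤ 0 := mul_nonpos_of_nonpos_of_nonneg (by linarith) (by positivity)
    linarith
  exact ⟨by linarith, h3.trans (mul_le_mul_of_nonneg_left h2 h4.le)⟩

theorem throughput_le {V : Type u} (σ : Input V) (x : Schedule) :
    throughput σ x ≤ σ.requests.length :=
  (Finset.card_filter_le _ _).trans (by simp)

namespace RandomizedOnlineAlgorithm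

variable {V : Type u} {S : StarMetric V} {Ω : Type v} [MeasurableSpace Ω]

theorem measurable_throughput (A : RandomizedOnlineAlgorithm S Ω) (σ : Input V) :
    Measurable fun ω => (throughput σ ((A.alg ω).run σ) : ℝ) := by
  have hset : ∀ i, MeasurableSet {ω | ((A.alg ω).run σ i).isSome} := by
    intro i
    have : {ω | ((A.alg ω).run σ i).isSome} =
        ⋃ n : ℕ, {ω | ∃ s : ℝ, s ≤ (n : ℝ) ∧ (A.alg ω).run σ i = some s} := by
      ext ω
      simp only [Set.mem_ofPred_eq, Set.mem_iUnion]
      constructor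
      · intro h
        obtain ⟨s, hs⟩ := Option.isSome_iff_exists.1 h
        obtain ⟨n, hn⟩ := exists_nat_ge s
        exact ⟨n, s, hn, hs⟩
      · rintro ⟨n, s, -, hs⟩
        simp [hs]
    rw [this]
    exact MeasurableSet.iUnion fun n => A.measurable_start σ i n
  unfold throughput
  simp only [Finset.card_filter, Nat.cast_sum]
  refine Finset.measurable_sum _ fun i _ => ?_
  simp only [Nat.cast_ite, Nat.cast_one, Nat.cast_zero]
  exact Measurable.ite (hset i) measurable_const measurable_const

theorem integrable_throughput (A : RandomizedOnlineAlgorithm S Ω) (P : Measure Ω)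
    [IsProbabilityMeasure P] (σ : Input V) :
    Integrable (fun ω => (throughput σ ((A.alg ω).run σ) : ℝ)) P := by
  refine Integrable.of_bound (A.measurable_throughput σ).aestronglyMeasurable
    (σ.requests.length : ℝ) (Filter.Eventually.of_forall fun ω => ?_)
  rw [Real.norm_of_nonneg (Nat.cast_nonneg _)]
  exact_mod_cast throughput_le _ _

theorem expectedThroughput_nonneg (A : RandomizedOnlineAlgorithm S Ω) (P : Measure Ω)
    (σ : Input V) : 0 ≤ A.expectedThroughput P σ :=
  integral_nonneg fun _ => Nat.cast_nonneg _

/-- The bound holds for each outcome with the same two inputs and the same `B`, so it can be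
integrated. -/
theorem expectedThroughput_add_le (A : RandomizedOnlineAlgorithm S Ω) (P : Measure Ω)
    [IsProbabilityMeasure P] {σ τ : Input V} {B : ℝ}
    (h : ∀ A : OnlineAlgorithm S,
      (throughput σ (A.run σ) : ℝ) + throughput τ (A.run τ) / 12 ≤ B) :
    A.expectedThroughput P σ + A.expectedThroughput P τ / 12 ≤ B := by
  unfold expectedThroughput
  have h1 := A.integrable_throughput P σ
  have h2 := (A.integrable_throughput P τ).div_const 12
  rw [← integral_div, ← integral_add h1 h2]
  calc _ ≤ ∫ _, B ∂P := integral_mono (h1.add h2) (integrable_const B) fun ω => h (A.alg ω)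
    _ = B := by simp

end RandomizedOnlineAlgorithm

/-- The choice of the number of blocks and of the length of the initial phase. -/
theorem ratio_bounds {W ρ : ℝ} {L : ℕ} (hL : 1 ≤ L)
    (h : ∀ H m : ℕ, L ≤ H → 1 ≤ m → ∃ w : ℝ, 1 / 2 ≤ w ∧ w ≤ W ∧ W ≤ 2 * w ∧ 1 ≤ ρ ∧
      m * w / 2 ≤ (ρ - 1) * (25 / 12 * H + 169 / 2 * m ^ 2 * w)) :
    (W / L ≤ 1 / 9 → 1 + 1 / 600 * √(W / L) ≤ ρ) ∧ (1 / 9 < W / L → 1.002 ≤ ρ) := by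
  have hL' : (1 : ℝ) ≤ L := by exact_mod_cast hL
  have hL0 : (0 : ℝ) < L := by linarith
  constructor
  · intro hδ
    obtain ⟨w₀, hw₀, hw₀', -⟩ := h L 1 le_rfl le_rfl
    have hW : 0 < W := by linarith
    set r := √(W / L) with hr
    have hr0 : 0 < r := Real.sqrt_pos.2 (by positivity)
    have hr2 : r ^ 2 * L = W := by
      rw [hr, Real.sq_sqrt (by positivity)]
      field_simp
    have hr3 : r ≤ 1 / 3 := by
      rw [hr, Real.sqrt_le_left (by norm_num)]
      exact hδ.trans (by norm_num)
    have hm1 : (⌊1 / r⌋₊ : ℝ) * r ≤ 1 := by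
      have := Nat.floor_le (a := 1 / r) (by positivity)
      rwa [le_div_iff₀ hr0] at this
    -- Rounding `1 / r` down costs at most `r ≤ 1 / 3`; this is where `δ ≤ 1 / 9` enters.
    have hm2 : 2 / 3 ≤ (⌊1 / r⌋₊ : ℝ) * r := by
      have := Nat.lt_floor_add_one (1 / r)
      rw [div_lt_iff₀ hr0] at this
      linarith
    set m := ⌊1 / r⌋₊ with hm
    have hm3 : 1 ≤ m := by
      by_contra hcon
      have : m = 0 := by omega
      rw [this] at hm2
      norm_num at hm2
    obtain ⟨w, hw1, hw2, hw3, hρ, hmain⟩ := h L m le_rfl hm3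
    have hm0 : (0 : ℝ) ≤ (m : ℝ) * r := by positivity
    have hsq : (m : ℝ) ^ 2 * w ≤ L := by
      calc (m : ℝ) ^ 2 * w ≤ (m : ℝ) ^ 2 * W := mul_le_mul_of_nonneg_left hw2 (by positivity)
        _ = ((m : ℝ) * r) ^ 2 * L := by rw [← hr2]; ring
        _ ≤ 1 * L := mul_le_mul_of_nonneg_right (pow_le_one₀ hm0 hm1) hL0.le
        _ = L := one_mul _
    have hlow : r * L / 6 ≤ m * w / 2 := by
      calc r * L / 6 = 2 / 3 * (r * L) / 4 := by ring
        _ ≤ ((m : ℝ) * r) * (r * L) / 4 := by gcongr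
        _ = (m : ℝ) * W / 4 := by rw [← hr2]; ring
        _ ≤ (m : ℝ) * (2 * w) / 4 := by gcongr
        _ = m * w / 2 := by ring
    -- `25 / 12 + 169 / 2 < 100`; with the `1 / 6` of `hlow` this yields `1 / 600`.
    have hup : (ρ - 1) * (25 / 12 * L + 169 / 2 * m ^ 2 * w) ≤ (ρ - 1) * (100 * L) :=
      mul_le_mul_of_nonneg_left (by linarith) (by linarith)
    have hfin : r / 6 * L ≤ (ρ - 1) * 100 * L := by linarith
    have := le_of_mul_le_mul_right hfin hL0
    linarith
  · intro hδ
    have hLW : (L : ℝ) < 9 * W := by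
      rw [lt_div_iff₀ hL0] at hδ
      linarith
    have hLH : L ≤ ⌈9 * W⌉₊ := by
      have := hLW.le.trans (Nat.le_ceil _)
      exact_mod_cast this
    -- Now `L < 9 * W`, so an initial phase of about `9 * W` is long enough for the laxity and still
    -- `O(w)`: `⌈9 * W⌉₊ ≤ 20 * w`, since `W ≤ 2 * w` and `1 ≤ 2 * w`.
    obtain ⟨w, hw1, hw2, hw3, hρ, hmain⟩ := h ⌈9 * W⌉₊ 1 hLH le_rfl
    have hw0 : 0 < w := by linarith
    have hH := Nat.ceil_lt_add_one (a := 9 * W) (by linarith)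
    have hup : (ρ - 1) * (25 / 12 * ⌈9 * W⌉₊ + 169 / 2 * ((1 : ℕ) : ℝ) ^ 2 * w) ≤
        (ρ - 1) * (130 * w) :=
      mul_le_mul_of_nonneg_left (by push_cast; linarith) (by linarith)
    push_cast at hmain hup
    have hfin : 1 / 2 * w ≤ (ρ - 1) * 130 * w := by linarith
    have := le_of_mul_le_mul_right hfin hw0
    norm_num
    linarith

end StarTSP

theorem mainTheorem4 :
    ∃ c : ℝ, 0 < c ∧
      ∀ (V : Type*) [Fintype V] [Nontrivial V] (S : StarTSP.StarMetric V),
        (∀ x y : V, x ≠ y → 1 ≤ S.dist x y) →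
        ∀ (L : ℕ), 1 ≤ L → ∀ (δ : ℝ), δ = S.totalWeight / (L : ℝ) →
          (∀ (A : StarTSP.OnlineAlgorithm S) (ρ : ℝ), A.IsCompetitive L ρ →
            (δ ≤ 1 / 9 → 1 + c * √δ ≤ ρ) ∧ (1 / 9 < δ → 1.002 ≤ ρ)) ∧
          (∀ (Ω : Type*) [MeasurableSpace Ω] (P : MeasureTheory.Measure Ω)
            [MeasureTheory.IsProbabilityMeasure P]
            (A : StarTSP.RandomizedOnlineAlgorithm S Ω) (ρ : ℝ), A.IsCompetitive P L ρ →
            (δ ≤ 1 / 9 → 1 + c * √δ ≤ ρ) ∧ (1 / 9 < δ → 1.002 ≤ ρ)) := by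
  refine ⟨1 / 600, by norm_num, ?_⟩
  rintro V _ _ S hS L hL δ rfl
  constructor
  · intro A ρ hA
    refine StarTSP.ratio_bounds hL fun H m hLH hm => ?_
    obtain ⟨σ, τ, w, hσ, hτ, h1, h2, h3, h⟩ := StarTSP.exists_hard_inputs hS hL hLH hm
    have hm' : (0 : ℝ) < m := by exact_mod_cast hm
    exact ⟨w, h1, h2, h3, StarTSP.le_ratio_of_throughput_le (Nat.cast_nonneg _) (Nat.cast_nonneg _)
      (by positivity) (hA σ hσ) (hA τ hτ) (h A)⟩
  · intro Ω _ P _ A ρ hA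
    refine StarTSP.ratio_bounds hL fun H m hLH hm => ?_
    obtain ⟨σ, τ, w, hσ, hτ, h1, h2, h3, h⟩ := StarTSP.exists_hard_inputs hS hL hLH hm
    have hm' : (0 : ℝ) < m := by exact_mod_cast hm
    exact ⟨w, h1, h2, h3, StarTSP.le_ratio_of_throughput_le (A.expectedThroughput_nonneg P σ)
      (A.expectedThroughput_nonneg P τ) (by positivity) (hA σ hσ) (hA τ hτ)
      (A.expectedThroughput_add_le P h)⟩
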